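/- **Setting.** Let $\mathbf M$ and $\mathbf Q$ be small symmetric monoidal categories with the same objects, the same tensor product on objects and the same unit $I$, and let $J:\mathbf M\to\mathbf Q$ be a strict symmetric monoidal functor that is the identity on objects. Assume that in $\mathbf Q$ the tensor product distributes over the binary coproducts that exist in $\mathbf Q$: if $A+B$ exists, then $(A+B)\otimes X$ is a coproduct of $A\otimes X$ and $B\otimes X$. Let $\mathcal V$ be the cartesian closed category of bisets: objects are functions $X_1\to X_0$ of sets, morphisms are commutative squares. Let $\mathbf C$ be the $\mathcal V$-category with the objects of $\mathbf Q$ and hom-objects $\mathbf C(A,B)=\big(J:\mathbf M(A,B)\to\mathbf Q(A,B)\big)$, and let $\overline{\mathbf C}=\mathcal V^{\mathbf C^{op}}$ be the $\mathcal V$-category of $\mathcal V$-functors $\mathbf C^{op}\to\mathcal V$, with the Day convolution $(F\otimes_{Day}G)(C)=\int^{A,B}\mathbf C(C,A\otimes B)\times FA\times GB$ and unit $\mathbf C(-,I)$. A $\mathcal V$-functor $F:\mathbf C^{op}\to\mathcal V$ amounts to functors $F^0:\mathbf Q^{op}\to\mathbf{Set}$, $F^1:\mathbf M^{op}\to\mathbf{Set}$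 and a natural transformation $h:F^1\to F^0\circ J^{op}$. Call $F$ *smooth* if $F^0$ preserves the binary products that exist in $\mathbf Q^{op}$, i.e. $F^0(A+B)\cong F^0A\times F^0B$ canonically whenever $A+B$ exists in $\mathbf Q$. Let $i:\widetilde{\mathbf C}\hookrightarrow\overline{\mathbf C}$ be the full $\mathcal V$-subcategory of smooth functors. It has the reflection $\widetilde L:\overline{\mathbf C}\to\widetilde{\mathbf C}$, $(\widetilde LF)(A)=\big((F A)_1\to (FA)_0\to (LF^0)(A)\big)$, where $L$ is the left adjoint of the inclusion of the product-preserving functors into $\mathbf{Set}^{\mathbf Q^{op}}$; write $\eta^L:\mathrm{id}\to i\widetilde L$ and $\varepsilon:\widetilde Li\to\mathrm{id}$ for its unit and counit. Equip $\widetilde{\mathbf C}$ with the tensor product $F\otimes G=\widetilde L(iF\otimes_{Day}iG)$, the unit $\mathbf C(-,I)$, the unitors and the symmetry obtained from those of Day convolution by applying $\widetilde L$ (followed by $\varepsilon$ for the unitors), and the associator $a$ determined by $a\circ\widetilde L(\eta^L\otimes_{Day} iH)=\widetilde L(iF\otimes_{Day}\eta^L)\circ\widetilde L\alpha$, with $\alpha$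 the associator of Day convolution. Regard $\mathbf{Set}$ as a $\mathcal V$-category with hom-objects $\big(\mathrm{id}:\mathbf{Set}(X,Y)\to\mathbf{Set}(X,Y)\big)$, and let $U_0:\mathcal V\to\mathbf{Set}$, $U_0(X_1\to X_0)=X_0$, and its right adjoint $\Delta:\mathbf{Set}\to\mathcal V$, $\Delta S=(\mathrm{id}:S\to S)$, be the evident $\mathcal V$-functors. Composition with them gives $\overline{U}_0$ and $\overline\Delta$ between $\overline{\mathbf C}$ and $\mathbf{Set}^{\mathbf C^{op}}$, and $\overline T=\overline\Delta\circ\overline U_0$. The Day strength $\overline t_{F,G}:F\otimes_{Day}\overline TG\to\overline T(F\otimes_{Day}G)$ is induced on coends by the strength of the monad $\Delta U_0$ on $\mathcal V$. The functors $\overline U_0$ and $\overline\Delta$ restrict to smooth functors; let $\overline U_0'$ and $\overline\Delta'$ be the restrictions and $\widetilde T=\overline\Delta'\circ\overline U_0':\widetilde{\mathbf C}\to\widetilde{\mathbf C}$, with the unit $\widetilde\eta$ and multiplication $\widetilde\mu$ given by the adjunction $\overline U_0'\dashv\overline\Delta'$. Let $\beta: i\widetilde T\to\overline Ti$ be the canonical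 (identity) isomorphism, and set $$\rho_F=\Big(\widetilde L\overline TF\xrightarrow{\widetilde L\overline T\eta^L}\widetilde L\overline Ti\widetilde LF\xrightarrow{\widetilde L\beta^{-1}}\widetilde Li\widetilde T\widetilde LF\xrightarrow{\ \varepsilon\ }\widetilde T\widetilde LF\Big),$$ $$\widetilde t_{F,G}=\Big(F\otimes\widetilde TG=\widetilde L(iF\otimes_{Day} i\widetilde TG)\xrightarrow{\widetilde L(iF\otimes\beta)}\widetilde L(iF\otimes_{Day}\overline TiG)\xrightarrow{\widetilde L\overline t}\widetilde L\overline T(iF\otimes_{Day}iG)\xrightarrow{\ \rho\ }\widetilde T(F\otimes G)\Big).$$ **Theorem.** With this structure $\widetilde{\mathbf C}$ is a symmetric monoidal $\mathcal V$-category, and $(\widetilde T,\widetilde\eta,\widetilde\mu,\widetilde t)$ is a commutative strong $\mathcal V$-monad on it. That is: $(\widetilde T,\widetilde\eta,\widetilde\mu)$ is a $\mathcal V$-monad; $\widetilde t$ is $\mathcal V$-natural in both arguments and compatible with $\widetilde\eta$, $\widetilde\mu$, the associator and the left unitor; and, with the costrength $\widetilde s_{F,G}=\widetilde T\gamma\circ\widetilde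 t_{G,F}\circ\gamma:\widetilde TF\otimes G\to\widetilde T(F\otimes G)$ obtained from the symmetry $\gamma$, $$\widetilde\mu\circ\widetilde T\widetilde t_{F,G}\circ\widetilde s_{F,\widetilde TG}=\widetilde\mu\circ\widetilde T\widetilde s_{F,G}\circ\widetilde t_{\widetilde TF,G}:\ \widetilde TF\otimes\widetilde TG\to\widetilde T(F\otimes G).$$ -/

import Mathlib

open CategoryTheory MonoidalCategory Opposite Limits

universe w v u u₁ u₂ u₃


section EnrichedNotions

variable (V : Type v) [Category.{w} V] [MonoidalCategory V]

/-- A map `X → Y` in a `V`-category: a morphism `I ⟶ A(X, Y)` of `V`. -/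
abbrev EMap {A : Type u₁} [EnrichedCategory V A] (X Y : A) : Type w := 𝟙_ V ⟶ (X ⟶[V] Y)

variable {V}

namespace EMap

variable {A : Type u₁} [EnrichedCategory V A] {B : Type u₂} [EnrichedCategory V B]

/-- Composition of maps (in diagrammatic order). -/
def comp {X Y Z : A} (f : EMap V X Y) (g : EMap V Y Z) : EMap V X Z :=
  (λ_ (𝟙_ V)).inv ≫ (f ⊗ₘ g) ≫ eComp V X Y Z

/-- `A(X, g) : A(X, Y) ⟶ A(X, Z)`. -/
def post (X : A) {Y Z : A} (g : EMap V Y Z) : (X ⟶[V] Y) ⟶ (X ⟶[V] Z) :=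
  (ρ_ _).inv ≫ (_ ◁ g) ≫ eComp V X Y Z

/-- `A(f, Z) : A(Y, Z) ⟶ A(X, Z)`. -/
def pre {X Y : A} (f : EMap V X Y) (Z : A) : (Y ⟶[V] Z) ⟶ (X ⟶[V] Z) :=
  (λ_ _).inv ≫ (f ▷ _) ≫ eComp V X Y Z

/-- The action of a `V`-functor on maps. -/
def image (F : EnrichedFunctor V A B) {X Y : A} (f : EMap V X Y) : EMap V (F.obj X) (F.obj Y) :=
  f ≫ F.map X Y

/-- A map is an isomorphism if it has a two-sided inverse. -/
def IsInvertible {X Y : A} (f : EMap V X Y) : Prop :=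
  ∃ g : EMap V Y X, f.comp g = eId V X ∧ g.comp f = eId V Y

end EMap

/-- `V`-naturality of a family of maps `F X → G X`. -/
def IsVNatural {A : Type u₁} [EnrichedCategory V A] {B : Type u₂} [EnrichedCategory V B]
    (F G : EnrichedFunctor V A B) (α : ∀ X, EMap V (F.obj X) (G.obj X)) : Prop :=
  ∀ X Y, F.map X Y ≫ EMap.post _ (α Y) = G.map X Y ≫ EMap.pre (α X) _

variable (V) in
/-- The data of a symmetric monoidal structure on a `V`-category. -/
structure TensorData (A : Type u₁) [EnrichedCategory V A] where
  unit : A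
  obj : A → A → A
  hom (X₁ X₂ Y₁ Y₂ : A) : (X₁ ⟶[V] Y₁) ⊗ (X₂ ⟶[V] Y₂) ⟶ (obj X₁ X₂ ⟶[V] obj Y₁ Y₂)
  assoc (X Y Z : A) : EMap V (obj (obj X Y) Z) (obj X (obj Y Z))
  leftUnitor (X : A) : EMap V (obj unit X) X
  rightUnitor (X : A) : EMap V (obj X unit) X
  braiding (X Y : A) : EMap V (obj X Y) (obj Y X)

/-- The tensor product `f ⊗ g` of two maps. -/
def TensorData.tensorMap {A : Type u₁} [EnrichedCategory V A] (D : TensorData V A)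
    {X₁ X₂ Y₁ Y₂ : A} (f : EMap V X₁ Y₁) (g : EMap V X₂ Y₂) :
    EMap V (D.obj X₁ X₂) (D.obj Y₁ Y₂) :=
  (λ_ (𝟙_ V)).inv ≫ (f ⊗ₘ g) ≫ D.hom X₁ X₂ Y₁ Y₂

/-- The laws of a symmetric monoidal `V`-category. -/
structure TensorData.IsSymmetricMonoidal [BraidedCategory V] {A : Type u₁} [EnrichedCategory V A]
    (D : TensorData V A) : Prop where
  tensor_id (X Y : A) : D.tensorMap (eId V X) (eId V Y) = eId V (D.obj X Y)
  tensor_comp (X₁ X₂ Y₁ Y₂ Z₁ Z₂ : A) :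
    tensorμ (X₁ ⟶[V] Y₁) (X₂ ⟶[V] Y₂) (Y₁ ⟶[V] Z₁) (Y₂ ⟶[V] Z₂) ≫
        (eComp V X₁ Y₁ Z₁ ⊗ₘ eComp V X₂ Y₂ Z₂) ≫ D.hom X₁ X₂ Z₁ Z₂ =
      (D.hom X₁ X₂ Y₁ Y₂ ⊗ₘ D.hom Y₁ Y₂ Z₁ Z₂) ≫
        eComp V (D.obj X₁ X₂) (D.obj Y₁ Y₂) (D.obj Z₁ Z₂)
  assoc_natural (X₁ X₂ X₃ Y₁ Y₂ Y₃ : A) :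
    (D.hom X₁ X₂ Y₁ Y₂ ▷ (X₃ ⟶[V] Y₃)) ≫ D.hom _ X₃ _ Y₃ ≫ EMap.post _ (D.assoc Y₁ Y₂ Y₃) =
      (α_ _ _ _).hom ≫ ((X₁ ⟶[V] Y₁) ◁ D.hom X₂ X₃ Y₂ Y₃) ≫ D.hom X₁ _ Y₁ _ ≫
        EMap.pre (D.assoc X₁ X₂ X₃) _
  leftUnitor_natural (X Y : A) :
    (λ_ (X ⟶[V] Y)).inv ≫ (eId V D.unit ▷ _) ≫ D.hom _ _ _ _ ≫ EMap.post _ (D.leftUnitor Y) =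
      EMap.pre (D.leftUnitor X) Y
  rightUnitor_natural (X Y : A) :
    (ρ_ (X ⟶[V] Y)).inv ≫ (_ ◁ eId V D.unit) ≫ D.hom _ _ _ _ ≫ EMap.post _ (D.rightUnitor Y) =
      EMap.pre (D.rightUnitor X) Y
  braiding_natural (X₁ X₂ Y₁ Y₂ : A) :
    D.hom X₁ X₂ Y₁ Y₂ ≫ EMap.post _ (D.braiding Y₁ Y₂) =
      (β_ (X₁ ⟶[V] Y₁) (X₂ ⟶[V] Y₂)).hom ≫ D.hom X₂ X₁ Y₂ Y₁ ≫ EMap.pre (D.braiding X₁ X₂) _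
  assoc_invertible (X Y Z : A) : (D.assoc X Y Z).IsInvertible
  leftUnitor_invertible (X : A) : (D.leftUnitor X).IsInvertible
  rightUnitor_invertible (X : A) : (D.rightUnitor X).IsInvertible
  symmetry (X Y : A) : (D.braiding X Y).comp (D.braiding Y X) = eId V (D.obj X Y)
  pentagon (W X Y Z : A) :
    ((D.tensorMap (D.assoc W X Y) (eId V Z)).comp (D.assoc W (D.obj X Y) Z)).comp
        (D.tensorMap (eId V W) (D.assoc X Y Z)) =
      (D.assoc (D.obj W X) Y Z).comp (D.assoc W X (D.obj Y Z))
  triangle (X Y : A) :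
    (D.assoc X D.unit Y).comp (D.tensorMap (eId V X) (D.leftUnitor Y)) =
      D.tensorMap (D.rightUnitor X) (eId V Y)
  hexagon (X Y Z : A) :
    ((D.assoc X Y Z).comp (D.braiding X (D.obj Y Z))).comp (D.assoc Y Z X) =
      ((D.tensorMap (D.braiding X Y) (eId V Z)).comp (D.assoc Y X Z)).comp
        (D.tensorMap (eId V Y) (D.braiding X Z))

/-- `(T, η, μ)` is a `V`-monad. -/
structure IsVMonad {A : Type u₁} [EnrichedCategory V A] (T : EnrichedFunctor V A A)
    (η : ∀ X, EMap V X (T.obj X)) (μ : ∀ X, EMap V (T.obj (T.obj X)) (T.obj X)) : Prop where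
  unit_natural : IsVNatural (EnrichedFunctor.id V A) T η
  mul_natural : IsVNatural (T.comp V T) T μ
  assoc (X : A) : ((μ X).image T).comp (μ X) = (μ (T.obj X)).comp (μ X)
  left_unit (X : A) : (η (T.obj X)).comp (μ X) = eId V (T.obj X)
  right_unit (X : A) : ((η X).image T).comp (μ X) = eId V (T.obj X)

/-- `t : X ⊗ T Y → T (X ⊗ Y)` is a strength for the `V`-monad `(T, η, μ)`. -/
structure IsStrength {A : Type u₁} [EnrichedCategory V A] (D : TensorData V A)
    (T : EnrichedFunctor V A A) (η : ∀ X, EMap V X (T.obj X))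
    (μ : ∀ X, EMap V (T.obj (T.obj X)) (T.obj X))
    (t : ∀ X Y, EMap V (D.obj X (T.obj Y)) (T.obj (D.obj X Y))) : Prop where
  natural (X₁ X₂ Y₁ Y₂ : A) :
    ((X₁ ⟶[V] Y₁) ◁ T.map X₂ Y₂) ≫ D.hom X₁ (T.obj X₂) Y₁ (T.obj Y₂) ≫ EMap.post _ (t Y₁ Y₂) =
      D.hom X₁ X₂ Y₁ Y₂ ≫ T.map _ _ ≫ EMap.pre (t X₁ X₂) _
  unit (X Y : A) : (D.tensorMap (eId V X) (η Y)).comp (t X Y) = η (D.obj X Y)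
  mul (X Y : A) :
    ((t X (T.obj Y)).comp ((t X Y).image T)).comp (μ (D.obj X Y)) =
      (D.tensorMap (eId V X) (μ Y)).comp (t X Y)
  assoc (X Y Z : A) :
    (t (D.obj X Y) Z).comp ((D.assoc X Y Z).image T) =
      ((D.assoc X Y (T.obj Z)).comp (D.tensorMap (eId V X) (t Y Z))).comp (t X (D.obj Y Z))
  leftUnitor (X : A) :
    (t D.unit X).comp ((D.leftUnitor X).image T) = D.leftUnitor (T.obj X)

/-- The costrength `T X ⊗ Y → T (X ⊗ Y)` obtained from a strength and the symmetry. -/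
def costrength {A : Type u₁} [EnrichedCategory V A] (D : TensorData V A)
    (T : EnrichedFunctor V A A) (t : ∀ X Y, EMap V (D.obj X (T.obj Y)) (T.obj (D.obj X Y)))
    (X Y : A) : EMap V (D.obj (T.obj X) Y) (T.obj (D.obj X Y)) :=
  ((D.braiding (T.obj X) Y).comp (t Y X)).comp ((D.braiding Y X).image T)

/-- `(T, η, μ, t)` is a commutative strong `V`-monad on a `V`-category with tensor data `D`. -/
structure IsCommutativeStrongVMonad {A : Type u₁} [EnrichedCategory V A] (D : TensorData V A)
    (T : EnrichedFunctor V A A) (η : ∀ X, EMap V X (T.obj X))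
    (μ : ∀ X, EMap V (T.obj (T.obj X)) (T.obj X))
    (t : ∀ X Y, EMap V (D.obj X (T.obj Y)) (T.obj (D.obj X Y))) : Prop where
  monad : IsVMonad T η μ
  strength : IsStrength D T η μ t
  commutative (X Y : A) :
    ((costrength D T t X (T.obj Y)).comp ((t X Y).image T)).comp (μ (D.obj X Y)) =
      ((t (T.obj X) Y).comp ((costrength D T t X Y).image T)).comp (μ (D.obj X Y))

/-- A full `V`-subcategory: the objects of `A` satisfying `P`, with the hom-objects of `A`. -/
structure FullSub {A : Type u₁} (P : A → Prop) where
  obj : A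
  prop : P obj

instance {A : Type u₁} [EnrichedCategory V A] (P : A → Prop) :
    EnrichedCategory V (FullSub P) where
  Hom X Y := X.obj ⟶[V] Y.obj
  id X := eId V X.obj
  comp X Y Z := eComp V X.obj Y.obj Z.obj
  id_comp X Y := e_id_comp V X.obj Y.obj
  comp_id X Y := e_comp_id V X.obj Y.obj
  assoc W X Y Z := e_assoc V W.obj X.obj Y.obj Z.obj

/-- The inclusion of a full `V`-subcategory. -/
def FullSub.incl {A : Type u₁} [EnrichedCategory V A] (P : A → Prop) :
    EnrichedFunctor V (FullSub P) A where
  obj X := X.obj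
  map X Y := 𝟙 (X.obj ⟶[V] Y.obj)
  map_id _ := Category.comp_id _
  map_comp X Y Z := by
    refine (Category.comp_id (eComp V X.obj Y.obj Z.obj)).trans ?_
    exact ((congrArg (· ≫ eComp V X.obj Y.obj Z.obj)
      (id_tensorHom_id (X.obj ⟶[V] Y.obj) (Y.obj ⟶[V] Z.obj))).trans (Category.id_comp _)).symm

/-- The restriction of a `V`-functor to full `V`-subcategories. -/
def FullSub.restrict {A : Type u₁} [EnrichedCategory V A] {B : Type u₂} [EnrichedCategory V B]
    {P : A → Prop} {R : B → Prop} (F : EnrichedFunctor V A B) (h : ∀ X, P X → R (F.obj X)) :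
    EnrichedFunctor V (FullSub P) (FullSub R) where
  obj X := ⟨F.obj X.obj, h _ X.prop⟩
  map X Y := F.map X.obj Y.obj
  map_id X := F.map_id X.obj
  map_comp X Y Z := F.map_comp X.obj Y.obj Z.obj

end EnrichedNotions

/-- A biset: sets `X₀`, `X₁` and a function `X₁ → X₀`. -/
structure Biset : Type (u + 1) where
  zero : Type u
  one : Type u
  map : one → zero

namespace Biset

/-- A morphism of bisets: a commutative square. -/
@[ext]
structure Hom (X Y : Biset.{u}) : Type u where
  zero : X.zero → Y.zero
  one : X.one → Y.one
  comm (x : X.one) : Y.map (one x) = zero (X.map x)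

instance : Category Biset.{u} where
  Hom := Hom
  id X := ⟨fun x => x, fun x => x, fun _ => rfl⟩
  comp f g := ⟨fun x => g.zero (f.zero x), fun x => g.one (f.one x),
    fun x => (g.comm _).trans (congrArg g.zero (f.comm x))⟩

@[ext]
theorem hom_ext {X Y : Biset.{u}} {f g : X ⟶ Y} (h₀ : ∀ x, Hom.zero f x = Hom.zero g x)
    (h₁ : ∀ x, Hom.one f x = Hom.one g x) : f = g :=
  Hom.ext (funext h₀) (funext h₁)

/-- The product of bisets. -/
def prod (X Y : Biset.{u}) : Biset.{u} :=
  ⟨X.zero × Y.zero, X.one × Y.one, fun p => (X.map p.1, Y.map p.2)⟩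

/-- The terminal biset. -/
def terminal : Biset.{u} := ⟨PUnit, PUnit, fun _ => PUnit.unit⟩

/-- The product of two morphisms. -/
def prodMap {X Y X' Y' : Biset.{u}} (f : X ⟶ X') (g : Y ⟶ Y') : prod X Y ⟶ prod X' Y' :=
  ⟨fun p => (Hom.zero f p.1, Hom.zero g p.2), fun p => (Hom.one f p.1, Hom.one g p.2),
    fun p => Prod.ext (Hom.comm f p.1) (Hom.comm g p.2)⟩

/-- The cartesian monoidal structure on bisets. -/
instance : MonoidalCategoryStruct Biset.{u} where
  tensorObj := prod
  tensorUnit := terminal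
  tensorHom := prodMap
  whiskerLeft X _ _ g := prodMap (𝟙 X) g
  whiskerRight f Y := prodMap f (𝟙 Y)
  associator X Y Z :=
    { hom := ⟨fun p => (p.1.1, (p.1.2, p.2)), fun p => (p.1.1, (p.1.2, p.2)), fun _ => rfl⟩
      inv := ⟨fun p => ((p.1, p.2.1), p.2.2), fun p => ((p.1, p.2.1), p.2.2), fun _ => rfl⟩
      hom_inv_id := rfl
      inv_hom_id := rfl }
  leftUnitor X :=
    { hom := ⟨fun p => p.2, fun p => p.2, fun _ => rfl⟩
      inv := ⟨fun p => (PUnit.unit, p), fun p => (PUnit.unit, p), fun _ => rfl⟩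
      hom_inv_id := rfl
      inv_hom_id := rfl }
  rightUnitor X :=
    { hom := ⟨fun p => p.1, fun p => p.1, fun _ => rfl⟩
      inv := ⟨fun p => (p, PUnit.unit), fun p => (p, PUnit.unit), fun _ => rfl⟩
      hom_inv_id := rfl
      inv_hom_id := rfl }

instance : MonoidalCategory Biset.{u} :=
  MonoidalCategory.ofTensorHom
    (id_tensorHom_id := fun _ _ => rfl)
    (id_tensorHom := fun _ _ _ _ => rfl)
    (tensorHom_id := fun _ _ => rfl)
    (tensorHom_comp_tensorHom := fun _ _ _ _ => rfl)
    (associator_naturality := fun _ _ _ => rfl)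
    (leftUnitor_naturality := fun _ => rfl)
    (rightUnitor_naturality := fun _ => rfl)
    (pentagon := fun _ _ _ _ => rfl)
    (triangle := fun _ _ => rfl)

instance : SymmetricCategory Biset.{u} where
  braiding X Y :=
    { hom := ⟨fun p => (p.2, p.1), fun p => (p.2, p.1), fun _ => rfl⟩
      inv := ⟨fun p => (p.2, p.1), fun p => (p.2, p.1), fun _ => rfl⟩
      hom_inv_id := rfl
      inv_hom_id := rfl }
  braiding_naturality_right _ _ _ _ := rfl
  braiding_naturality_left _ _ := rfl
  hexagon_forward _ _ _ := rfl
  hexagon_reverse _ _ _ := rfl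
  symmetry _ _ := rfl

/-- The global element `1 ⟶ X` given by an element of `X₁`. -/
def point {X : Biset.{u}} (x : X.one) : 𝟙_ Biset.{u} ⟶ X :=
  ⟨fun _ => X.map x, fun _ => x, fun _ => rfl⟩

/-- Bisets as a `Biset`-category: the hom-object is the exponential `X ⇒ Y`, with
`(X ⇒ Y)₀ = Set(X₀, Y₀)` and `(X ⇒ Y)₁ = Hom(X, Y)`. -/
instance selfEnriched : EnrichedCategory Biset.{u} Biset.{u} where
  Hom X Y := ⟨X.zero → Y.zero, X ⟶ Y, fun f => Hom.zero f⟩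
  id X := ⟨fun _ x => x, fun _ => 𝟙 X, fun _ => rfl⟩
  comp X Y Z := ⟨fun p x => p.2 (p.1 x), fun p => p.1 ≫ p.2, fun _ => rfl⟩
  id_comp _ _ := rfl
  comp_id _ _ := rfl
  assoc _ _ _ _ := rfl

/-- `Set` as a `Biset`-category, with hom-objects `(Set(X, Y), Set(X, Y), id)`. -/
instance setEnriched : EnrichedCategory Biset.{u} (Type u) where
  Hom X Y := ⟨X → Y, X → Y, fun f => f⟩
  id X := ⟨fun _ x => x, fun _ x => x, fun _ => rfl⟩
  comp X Y Z := ⟨fun p x => p.2 (p.1 x), fun p x => p.2 (p.1 x), fun _ => rfl⟩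
  id_comp _ _ := rfl
  comp_id _ _ := rfl
  assoc _ _ _ _ := rfl

/-- The `Biset`-functor `U₀(X) = X₀`. -/
def U₀ : EnrichedFunctor Biset.{u} Biset.{u} (Type u) where
  obj X := X.zero
  map X Y := ⟨fun f => f, fun f => Hom.zero f, fun _ => rfl⟩
  map_id _ := rfl
  map_comp _ _ _ := rfl

/-- The `Biset`-functor `Δ(X) = (X, X, id)`. -/
def Δ : EnrichedFunctor Biset.{u} (Type u) Biset.{u} where
  obj X := ⟨X, X, fun x => x⟩
  map X Y := ⟨fun f => f, fun f => ⟨f, f, fun _ => rfl⟩, fun _ => rfl⟩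
  map_id _ := rfl
  map_comp _ _ _ := rfl

end Biset

section DayConvolution

variable {K : Type u} [Category.{u} K] [MonoidalCategory K]

/-- A generator of `∫^{a,b} K(c, a ⊗ b) × P a × R b`. -/
structure DayGen (P R : Kᵒᵖ ⥤ Type u) (c : K) : Type u where
  left : K
  right : K
  arrow : c ⟶ left ⊗ right
  x : P.obj (op left)
  y : R.obj (op right)

/-- The relations of the coend `∫^{a,b} K(c, a ⊗ b) × P a × R b`. -/
inductive DayRel (P R : Kᵒᵖ ⥤ Type u) (c : K) : DayGen P R c → DayGen P R c → Prop
  | glide {a a' b b' : K} (f : c ⟶ a ⊗ b) (s : a ⟶ a') (t : b ⟶ b')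
      (x : P.obj (op a')) (y : R.obj (op b')) :
      DayRel P R c ⟨a', b', f ≫ (s ⊗ₘ t), x, y⟩ ⟨a, b, f, P.map s.op x, R.map t.op y⟩

/-- The coend `∫^{a,b} K(c, a ⊗ b) × P a × R b`. -/
def DayObj (P R : Kᵒᵖ ⥤ Type u) (c : K) : Type u := Quot (DayRel P R c)

/-- The class of a generator. -/
def DayObj.mk {P R : Kᵒᵖ ⥤ Type u} {c a b : K} (f : c ⟶ a ⊗ b) (x : P.obj (op a))
    (y : R.obj (op b)) : DayObj P R c :=
  Quot.mk _ ⟨a, b, f, x, y⟩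

theorem DayObj.glide {P R : Kᵒᵖ ⥤ Type u} {c a a' b b' : K} (f : c ⟶ a ⊗ b) (s : a ⟶ a')
    (t : b ⟶ b') (x : P.obj (op a')) (y : R.obj (op b')) :
    DayObj.mk (f ≫ (s ⊗ₘ t)) x y = DayObj.mk f (P.map s.op x) (R.map t.op y) :=
  Quot.sound (DayRel.glide f s t x y)

theorem DayObj.ind {P R : Kᵒᵖ ⥤ Type u} {c : K} {p : DayObj P R c → Prop}
    (h : ∀ {a b : K} (f : c ⟶ a ⊗ b) (x : P.obj (op a)) (y : R.obj (op b)), p (DayObj.mk f x y))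
    (q : DayObj P R c) : p q :=
  Quot.ind (fun g => h g.arrow g.x g.y) q

/-- Functions out of the coend. -/
def DayObj.lift {P R : Kᵒᵖ ⥤ Type u} {c : K} {S : Type u}
    (φ : ∀ {a b : K}, (c ⟶ a ⊗ b) → P.obj (op a) → R.obj (op b) → S)
    (h : ∀ {a a' b b' : K} (f : c ⟶ a ⊗ b) (s : a ⟶ a') (t : b ⟶ b') (x : P.obj (op a'))
      (y : R.obj (op b')), φ (f ≫ (s ⊗ₘ t)) x y = φ f (P.map s.op x) (R.map t.op y))
    (q : DayObj P R c) : S :=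
  Quot.lift (fun g => φ g.arrow g.x g.y) (fun _ _ r => by
    cases r with
    | glide f s t x y => exact h f s t x y) q

/-- The Day convolution of two presheaves of sets. -/
def day (P R : Kᵒᵖ ⥤ Type u) : Kᵒᵖ ⥤ Type u where
  obj c := DayObj P R c.unop
  map g := ↾(DayObj.lift (fun f x y => DayObj.mk (g.unop ≫ f) x y) (fun f s t x y => by
    rw [← Category.assoc]
    exact DayObj.glide (g.unop ≫ f) s t x y))
  map_id c := by
    ext q
    induction q using DayObj.ind with
    | h f x y => exact congrArg (fun k => DayObj.mk k x y) (Category.id_comp f)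
  map_comp g g' := by
    ext q
    induction q using DayObj.ind with
    | h f x y => exact congrArg (fun k => DayObj.mk k x y) (Category.assoc g'.unop g.unop f)

/-- Natural transformations out of a Day convolution. -/
def day.desc {P R Z : Kᵒᵖ ⥤ Type u}
    (φ : ∀ {c a b : K}, (c ⟶ a ⊗ b) → P.obj (op a) → R.obj (op b) → Z.obj (op c))
    (h : ∀ {c a a' b b' : K} (f : c ⟶ a ⊗ b) (s : a ⟶ a') (t : b ⟶ b') (x : P.obj (op a'))
      (y : R.obj (op b')), φ (f ≫ (s ⊗ₘ t)) x y = φ f (P.map s.op x) (R.map t.op y))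
    (h' : ∀ {c c' a b : K} (g : c' ⟶ c) (f : c ⟶ a ⊗ b) (x : P.obj (op a)) (y : R.obj (op b)),
      φ (g ≫ f) x y = Z.map g.op (φ f x y)) : day P R ⟶ Z where
  app c := ↾(DayObj.lift (fun f x y => φ f x y) (fun f s t x y => h f s t x y))
  naturality c c' g := by
    ext q
    induction q using DayObj.ind with
    | h f x y => exact h' g.unop f x y

/-- Functoriality of the Day convolution. -/
def day.map {P P' R R' : Kᵒᵖ ⥤ Type u} (m : P ⟶ P') (n : R ⟶ R') : day P R ⟶ day P' R' :=
  day.desc (Z := day P' R') (fun f x y => DayObj.mk f (m.app _ x) (n.app _ y))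
    (fun f s t x y => by
      rw [DayObj.glide, NatTrans.naturality_apply, NatTrans.naturality_apply])
    (fun _ _ _ _ => rfl)

theorem DayObj.glide_right {P R S : Kᵒᵖ ⥤ Type u} {c a a' d d' b b' : K} (f : c ⟶ a ⊗ (d ⊗ b))
    (s : a ⟶ a') (t : d ⟶ d') (r : b ⟶ b') (x : P.obj (op a')) (y : R.obj (op d'))
    (z : S.obj (op b')) :
    DayObj.mk (P := P) (R := day R S) (f ≫ (s ⊗ₘ (t ⊗ₘ r))) x (DayObj.mk (𝟙 _) y z) =
      DayObj.mk (P := P) (R := day R S) f (P.map s.op x)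
        (DayObj.mk (𝟙 _) (R.map t.op y) (S.map r.op z)) := by
  refine (DayObj.glide f s (t ⊗ₘ r) x _).trans ?_
  refine congrArg (fun w => DayObj.mk (P := P) (R := day R S) f (P.map s.op x) w) ?_
  refine Eq.trans ?_ (DayObj.glide (𝟙 _) t r y z)
  exact congrArg (fun k => DayObj.mk k y z) ((Category.comp_id _).trans (Category.id_comp _).symm)

/-- The associator of the Day convolution. -/
def day.assoc (P R S : Kᵒᵖ ⥤ Type u) : day (day P R) S ⟶ day P (day R S) :=
  day.desc (Z := day P (day R S))
    (fun {c e b} f q z => DayObj.lift (S := DayObj P (day R S) c)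
      (fun {a a'} g x y => DayObj.mk (f ≫ (g ▷ b) ≫ (α_ a a' b).hom) x
        (DayObj.mk (𝟙 (a' ⊗ b)) y z))
      (fun {a a' d d'} g s t x y => by
        have e : f ≫ (g ≫ (s ⊗ₘ t)) ▷ b ≫ (α_ a' d' b).hom =
            (f ≫ g ▷ b ≫ (α_ a d b).hom) ≫ (s ⊗ₘ (t ⊗ₘ 𝟙 b)) := by
          rw [Category.assoc, Category.assoc, ← associator_naturality, ← tensorHom_id g,
            tensorHom_comp_tensorHom_assoc, Category.comp_id, tensorHom_id]
        rw [e, DayObj.glide_right]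
        simp) q)
    (fun {c e e' b b'} f s t q z => by
      induction q using DayObj.ind with
      | h g x y =>
        rename_i a d
        change DayObj.mk (P := P) (R := day R S)
            ((f ≫ (s ⊗ₘ t)) ≫ g ▷ b' ≫ (α_ a d b').hom) x (DayObj.mk (𝟙 _) y z) =
          DayObj.mk (P := P) (R := day R S) (f ≫ (s ≫ g) ▷ b ≫ (α_ a d b).hom) x
            (DayObj.mk (𝟙 _) y (S.map t.op z))
        have e : (f ≫ (s ⊗ₘ t)) ≫ g ▷ b' ≫ (α_ a d b').hom =
            (f ≫ (s ≫ g) ▷ b ≫ (α_ a d b).hom) ≫ (𝟙 a ⊗ₘ (𝟙 d ⊗ₘ t)) := by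
          simp [MonoidalCategory.tensorHom_def, whisker_exchange_assoc]
        rw [e, DayObj.glide_right]
        simp)
    (fun {c c' e b} k f q z => by
      induction q using DayObj.ind with
      | h g x y =>
        exact congrArg (fun k => DayObj.mk (P := P) (R := day R S) k x (DayObj.mk (𝟙 _) y z))
          (Category.assoc k f _))

/-- The left unitor of the Day convolution; the unit is the presheaf represented by `I`. -/
def day.leftUnitor (P : Kᵒᵖ ⥤ Type u) : day (yoneda.obj (𝟙_ K)) P ⟶ P :=
  day.desc (fun {c a b} f i y => P.map (f ≫ ((show a ⟶ 𝟙_ K from i) ▷ b) ≫ (λ_ b).hom).op y)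
    (fun {c a a' b b'} f s t i y => by
      have e : (f ≫ (s ⊗ₘ t)) ≫ (show a' ⟶ 𝟙_ K from i) ▷ b' ≫ (λ_ b').hom =
          (f ≫ (s ≫ (show a' ⟶ 𝟙_ K from i)) ▷ b ≫ (λ_ b).hom) ≫ t := by
        simp [MonoidalCategory.tensorHom_def, whisker_exchange_assoc]
      rw [e, op_comp, Functor.map_comp]
      rfl)
    (fun k f i y => by
      rw [Category.assoc, op_comp, Functor.map_comp]
      rfl)

/-- The right unitor of the Day convolution. -/
def day.rightUnitor (P : Kᵒᵖ ⥤ Type u) : day P (yoneda.obj (𝟙_ K)) ⟶ P :=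
  day.desc (fun {c a b} f x i => P.map (f ≫ (a ◁ (show b ⟶ 𝟙_ K from i)) ≫ (ρ_ a).hom).op x)
    (fun {c a a' b b'} f s t x i => by
      have e : (f ≫ (s ⊗ₘ t)) ≫ a' ◁ (show b' ⟶ 𝟙_ K from i) ≫ (ρ_ a').hom =
          (f ≫ a ◁ (t ≫ (show b' ⟶ 𝟙_ K from i)) ≫ (ρ_ a).hom) ≫ s := by
        simp [tensorHom_def', ← whisker_exchange_assoc]
      rw [e, op_comp, Functor.map_comp]
      rfl)
    (fun k f x i => by
      rw [Category.assoc, op_comp, Functor.map_comp]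
      rfl)

/-- The braiding of the Day convolution. -/
def day.braiding [BraidedCategory K] (P R : Kᵒᵖ ⥤ Type u) : day P R ⟶ day R P :=
  day.desc (Z := day R P) (fun {c a b} f x y => DayObj.mk (f ≫ (β_ a b).hom) y x)
    (fun f s t x y => by
      rw [Category.assoc, BraidedCategory.braiding_naturality, ← Category.assoc, DayObj.glide])
    (fun g f x y => congrArg (fun k => DayObj.mk k y x) (Category.assoc g f _))

end DayConvolution

section Reflection

variable (Q : Type u) [Category.{u} Q]

/-- The presheaves `Qᵒᵖ ⥤ Set` that preserve binary products, that is, send every binary coproduct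
that exists in `Q` to a product of sets. -/
abbrev prodPreserving : ObjectProperty (Qᵒᵖ ⥤ Type u) :=
  ObjectProperty.preservesLimitsOfShape (Discrete WalkingPair)

instance : (prodPreserving Q).ι.IsRightAdjoint := by
  have : Fact (Cardinal.aleph0.{u}).IsRegular := ⟨Cardinal.isRegular_aleph0⟩
  have hy : ∀ X : Q, IsCardinalPresentable (shrinkYoneda.{u}.obj X) Cardinal.aleph0.{u} := fun X =>
    isCardinalPresentable_of_iso
      (uliftYonedaIsoYoneda.{u}.app X ≪≫ (shrinkYonedaIsoYoneda.app X).symm) _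
  rw [prodPreserving, Presheaf.preservesLimitsOfShape_eq_isLocal]
  refine MorphismProperty.isRightAdjoint_ι_isLocal _ Cardinal.aleph0.{u} ?_
  intro X Y f hf
  simp only [MorphismProperty.iSup_iff] at hf
  obtain ⟨F, ⟨h⟩⟩ := hf
  refine ⟨?_, hy _⟩
  have : ∀ k, IsCardinalPresentable ((F.leftOp ⋙ shrinkYoneda.{u}).obj k) Cardinal.aleph0.{u} :=
    fun k => hy _
  refine isCardinalPresentable_of_isColimit _ (colimit.isColimit (F.leftOp ⋙ shrinkYoneda.{u}))
    Cardinal.aleph0.{u} ?_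
  rw [hasCardinalLT_aleph0_iff]
  infer_instance

variable {Q}

/-- `L : Set^{Qᵒᵖ} → [Set^{Qᵒᵖ}]_prod`, the left adjoint of the inclusion. -/
noncomputable def reflector : (Qᵒᵖ ⥤ Type u) ⥤ (prodPreserving Q).FullSubcategory :=
  (prodPreserving Q).ι.leftAdjoint

/-- The adjunction of `L` and the inclusion. -/
noncomputable def reflectorAdj : reflector (Q := Q) ⊣ (prodPreserving Q).ι :=
  Adjunction.ofIsRightAdjoint _

/-- `i L : Set^{Qᵒᵖ} → Set^{Qᵒᵖ}`. -/
noncomputable abbrev refl₀ : (Qᵒᵖ ⥤ Type u) ⥤ (Qᵒᵖ ⥤ Type u) := reflector ⋙ (prodPreserving Q).ι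

/-- The unit `P → i L P`. -/
noncomputable abbrev reflUnit₀ (P : Qᵒᵖ ⥤ Type u) : P ⟶ refl₀.obj P := reflectorAdj.unit.app P

/-- The extension `i L P → Z` of `P → Z` along the unit, for product preserving `Z`. -/
noncomputable def reflLift₀ {P Z : Qᵒᵖ ⥤ Type u} (hZ : prodPreserving Q Z) (g : P ⟶ Z) :
    refl₀.obj P ⟶ Z :=
  (prodPreserving Q).ι.map ((reflectorAdj.homEquiv P ⟨Z, hZ⟩).symm g)

theorem reflLift₀_fac {P Z : Qᵒᵖ ⥤ Type u} (hZ : prodPreserving Q Z) (g : P ⟶ Z) :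
    reflUnit₀ P ≫ reflLift₀ hZ g = g := by
  have h := (reflectorAdj (Q := Q)).homEquiv_unit (X := P) (Y := ⟨Z, hZ⟩)
    (f := (reflectorAdj.homEquiv P ⟨Z, hZ⟩).symm g)
  rw [Equiv.apply_symm_apply] at h
  exact h.symm

variable [MonoidalCategory Q]

/-- The presheaves `c ↦ Z(c ⊗ -)`, functorially in `c`. -/
def shiftPsh (Z : Qᵒᵖ ⥤ Type u) : Qᵒᵖ ⥤ (Qᵒᵖ ⥤ Type u) where
  obj c := (tensorLeft c.unop).op ⋙ Z
  map f := { app := fun b => Z.map (f.unop ▷ b.unop).op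
             naturality := fun b b' g => by
              change Z.map _ ≫ Z.map _ = Z.map _ ≫ Z.map _
              rw [← Z.map_comp, ← Z.map_comp]
              congr 1
              exact congrArg Quiver.Hom.op (whisker_exchange f.unop g.unop).symm }
  map_id c := by ext b x; simp
  map_comp f g := by ext b x; simp

/-- The internal hom of the Day convolution: `(S ⊸ Z)(c) = Nat(S, Z(c ⊗ -))`. -/
def dayHom (S Z : Qᵒᵖ ⥤ Type u) : Qᵒᵖ ⥤ Type u := shiftPsh Z ⋙ coyoneda.obj (op S)

theorem dayHom_prodPreserving
    [∀ X : Q, PreservesColimitsOfShape (Discrete WalkingPair) (tensorRight X)]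
    (S : Qᵒᵖ ⥤ Type u) {Z : Qᵒᵖ ⥤ Type u} (hZ : prodPreserving Q Z) :
    prodPreserving Q (dayHom S Z) := by
  have : PreservesLimitsOfShape (Discrete WalkingPair) Z := hZ
  have : PreservesLimitsOfShape (Discrete WalkingPair) (shiftPsh Z) := by
    refine preservesLimitsOfShape_of_evaluation _ _ (fun b => ?_)
    have : PreservesColimitsOfShape (Discrete WalkingPair)ᵒᵖ (tensorRight b.unop) :=
      preservesColimitsOfShape_of_equiv (Discrete.opposite WalkingPair).symm _
    have : PreservesLimitsOfShape (Discrete WalkingPair) (tensorRight b.unop).op :=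
      preservesLimitsOfShape_op _ _
    exact inferInstanceAs
      (PreservesLimitsOfShape (Discrete WalkingPair) ((tensorRight b.unop).op ⋙ Z))
  exact inferInstanceAs
    (PreservesLimitsOfShape (Discrete WalkingPair) (shiftPsh Z ⋙ coyoneda.obj (op S)))

/-- Currying. -/
def dayCurry {P S Z : Qᵒᵖ ⥤ Type u} (g : day P S ⟶ Z) : P ⟶ dayHom S Z where
  app c := ↾(fun x =>
    { app := fun b => ↾(fun y => g.app (op (c.unop ⊗ b.unop)) (DayObj.mk (𝟙 _) x y))
      naturality := fun b b' h => by
        ext y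
        refine Eq.trans ?_ (NatTrans.naturality_apply g ((c.unop ◁ h.unop).op) _)
        refine congrArg (fun w => g.app (op (c.unop ⊗ b'.unop)) w) ?_
        have e := DayObj.glide (P := P) (R := S) (𝟙 (c.unop ⊗ b'.unop)) (𝟙 c.unop) h.unop x y
        rw [op_id, Functor.map_id_apply] at e
        refine e.symm.trans ?_
        refine congrArg (fun k => DayObj.mk (P := P) (R := S) k x y) ?_
        exact (Category.id_comp _).trans ((id_tensorHom _ _).trans (Category.comp_id _).symm) })
  naturality c c' h := by
    ext x
    refine NatTrans.ext (funext fun b => ?_)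
    ext y
    refine Eq.trans ?_ (NatTrans.naturality_apply g ((h.unop ▷ b.unop).op) _)
    refine congrArg (fun w => g.app (op (c'.unop ⊗ b.unop)) w) ?_
    have e := DayObj.glide (P := P) (R := S) (𝟙 (c'.unop ⊗ b.unop)) h.unop (𝟙 b.unop) x y
    rw [op_id, Functor.map_id_apply] at e
    refine e.symm.trans ?_
    refine congrArg (fun k => DayObj.mk (P := P) (R := S) k x y) ?_
    exact (Category.id_comp _).trans ((tensorHom_id _ _).trans (Category.comp_id _).symm)

/-- Evaluation of a curried natural transformation. -/
def dayEval {P S Z : Qᵒᵖ ⥤ Type u} (n : P ⟶ dayHom S Z) {a b : Q} (x : P.obj (op a))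
    (y : S.obj (op b)) : Z.obj (op (a ⊗ b)) :=
  (show S ⟶ (tensorLeft a).op ⋙ Z from n.app (op a) x).app (op b) y

theorem dayEval_map {P S Z : Qᵒᵖ ⥤ Type u} (n : P ⟶ dayHom S Z) {a a' b b' : Q} (s : a ⟶ a')
    (t : b ⟶ b') (x : P.obj (op a')) (y : S.obj (op b')) :
    dayEval n (P.map s.op x) (S.map t.op y) = Z.map (s ⊗ₘ t).op (dayEval n x y) := by
  have e₁ : n.app (op a) (P.map s.op x) = (dayHom S Z).map s.op (n.app (op a') x) :=
    NatTrans.naturality_apply n s.op x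
  have e₂ : dayEval n x (S.map t.op y) = Z.map (a' ◁ t).op (dayEval n x y) :=
    NatTrans.naturality_apply (show S ⟶ (tensorLeft a').op ⋙ Z from n.app (op a') x) t.op y
  have e₃ : dayEval n (P.map s.op x) (S.map t.op y) =
      Z.map (s ▷ b).op (dayEval n x (S.map t.op y)) :=
    congrArg (fun m : S ⟶ (tensorLeft a).op ⋙ Z => m.app (op b) (S.map t.op y)) e₁
  rw [e₃, e₂, MonoidalCategory.tensorHom_def, op_comp, Functor.map_comp_apply]

/-- Uncurrying. -/
def dayUncurry {P S Z : Qᵒᵖ ⥤ Type u} (n : P ⟶ dayHom S Z) : day P S ⟶ Z :=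
  day.desc (fun f x y => Z.map f.op (dayEval n x y))
    (fun f s t x y => by rw [dayEval_map, op_comp, Functor.map_comp_apply])
    (fun k f x y => by rw [op_comp, Functor.map_comp_apply])

/-- A natural transformation `P ⊗ S → Z` into a product preserving `Z` extends uniquely along
`P ⊗ S → i L P ⊗ S`. -/
noncomputable def dayExtend [∀ X : Q, PreservesColimitsOfShape (Discrete WalkingPair) (tensorRight X)]
    {P S Z : Qᵒᵖ ⥤ Type u} (hZ : prodPreserving Q Z) (g : day P S ⟶ Z) :
    day (refl₀.obj P) S ⟶ Z :=
  dayUncurry (reflLift₀ (dayHom_prodPreserving S hZ) (dayCurry g))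

theorem dayExtend_fac [∀ X : Q, PreservesColimitsOfShape (Discrete WalkingPair) (tensorRight X)]
    {P S Z : Qᵒᵖ ⥤ Type u} (hZ : prodPreserving Q Z) (g : day P S ⟶ Z) :
    day.map (reflUnit₀ P) (𝟙 S) ≫ dayExtend hZ g = g := by
  ext c q
  induction q using DayObj.ind with
  | h f x y =>
    rename_i a b
    have e : (reflLift₀ (dayHom_prodPreserving S hZ) (dayCurry g)).app (op a)
        ((reflUnit₀ P).app (op a) x) = (dayCurry g).app (op a) x :=
      ConcreteCategory.congr_hom (NatTrans.congr_app
        (reflLift₀_fac (dayHom_prodPreserving S hZ) (dayCurry g)) (op a)) x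
    have e' : dayEval (reflLift₀ (dayHom_prodPreserving S hZ) (dayCurry g))
        ((reflUnit₀ P).app (op a) x) y = dayEval (dayCurry g) x y :=
      congrArg (fun m : S ⟶ (tensorLeft a).op ⋙ Z => m.app (op b) y) e
    refine (congrArg (fun w => Z.map f.op w) e').trans ?_
    refine (NatTrans.naturality_apply g f.op _).symm.trans ?_
    exact congrArg (fun k => g.app c (DayObj.mk k x y)) (Category.comp_id f)

end Reflection

section FunctorCategories

variable {A : Type u₁} [EnrichedCategory Biset.{u} A] {B : Type u₂} [EnrichedCategory Biset.{u} B]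
  {D : Type u₃} [EnrichedCategory Biset.{u} D]

/-- `X →₀ Y`. -/
abbrev Hom₀ (X Y : A) : Type u := (X ⟶[Biset.{u}] Y).zero

/-- `X →₁ Y`. -/
abbrev Hom₁ (X Y : A) : Type u := (X ⟶[Biset.{u}] Y).one

/-- The structure map `φ` from `X →₁ Y` to `X →₀ Y`. -/
abbrev Hom₁.φ {X Y : A} (f : Hom₁ X Y) : Hom₀ X Y := (X ⟶[Biset.{u}] Y).map f

/-- Composition in `A₀` (diagrammatic order). -/
def comp₀ {X Y Z : A} (f : Hom₀ X Y) (g : Hom₀ Y Z) : Hom₀ X Z :=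
  Biset.Hom.zero (eComp Biset.{u} X Y Z) (f, g)

/-- Composition in `A₁` (diagrammatic order). -/
def comp₁ {X Y Z : A} (f : Hom₁ X Y) (g : Hom₁ Y Z) : Hom₁ X Z :=
  Biset.Hom.one (eComp Biset.{u} X Y Z) (f, g)

/-- The identity in `A₁`. -/
def id₁ (X : A) : Hom₁ X X := Biset.Hom.one (eId Biset.{u} X) PUnit.unit

/-- The identity in `A₀`. -/
def id₀ (X : A) : Hom₀ X X := Biset.Hom.zero (eId Biset.{u} X) PUnit.unit

/-- `F⁰` on morphisms. -/
def map₀ (F : EnrichedFunctor Biset.{u} A B) {X Y : A} (f : Hom₀ X Y) :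
    Hom₀ (F.obj X) (F.obj Y) := Biset.Hom.zero (F.map X Y) f

/-- `F¹` on morphisms. -/
def map₁ (F : EnrichedFunctor Biset.{u} A B) {X Y : A} (f : Hom₁ X Y) :
    Hom₁ (F.obj X) (F.obj Y) := Biset.Hom.one (F.map X Y) f

theorem φ_comp {X Y Z : A} (f : Hom₁ X Y) (g : Hom₁ Y Z) :
    (comp₁ f g).φ = comp₀ f.φ g.φ := Biset.Hom.comm (eComp Biset.{u} X Y Z) (f, g)

theorem φ_id (X : A) : (id₁ X).φ = id₀ X := Biset.Hom.comm (eId Biset.{u} X) PUnit.unit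

theorem φ_map (F : EnrichedFunctor Biset.{u} A B) {X Y : A} (f : Hom₁ X Y) :
    (map₁ F f).φ = map₀ F f.φ := Biset.Hom.comm (F.map X Y) f

theorem id_comp₀ {X Y : A} (f : Hom₀ X Y) : comp₀ (id₀ X) f = f :=
  congrFun (congrArg Biset.Hom.zero (e_id_comp Biset.{u} X Y)) f

theorem comp_id₀ {X Y : A} (f : Hom₀ X Y) : comp₀ f (id₀ Y) = f :=
  congrFun (congrArg Biset.Hom.zero (e_comp_id Biset.{u} X Y)) f

theorem assoc₀ {W X Y Z : A} (f : Hom₀ W X) (g : Hom₀ X Y) (h : Hom₀ Y Z) :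
    comp₀ (comp₀ f g) h = comp₀ f (comp₀ g h) :=
  congrFun (congrArg Biset.Hom.zero (e_assoc Biset.{u} W X Y Z)) (f, (g, h))

theorem id_comp₁ {X Y : A} (f : Hom₁ X Y) : comp₁ (id₁ X) f = f :=
  congrFun (congrArg Biset.Hom.one (e_id_comp Biset.{u} X Y)) f

theorem comp_id₁ {X Y : A} (f : Hom₁ X Y) : comp₁ f (id₁ Y) = f :=
  congrFun (congrArg Biset.Hom.one (e_comp_id Biset.{u} X Y)) f

theorem assoc₁ {W X Y Z : A} (f : Hom₁ W X) (g : Hom₁ X Y) (h : Hom₁ Y Z) :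
    comp₁ (comp₁ f g) h = comp₁ f (comp₁ g h) :=
  congrFun (congrArg Biset.Hom.one (e_assoc Biset.{u} W X Y Z)) (f, (g, h))

theorem map_comp₀ (F : EnrichedFunctor Biset.{u} A B) {X Y Z : A} (f : Hom₀ X Y) (g : Hom₀ Y Z) :
    map₀ F (comp₀ f g) = comp₀ (map₀ F f) (map₀ F g) :=
  congrFun (congrArg Biset.Hom.zero (F.map_comp X Y Z)) (f, g)

theorem map_comp₁ (F : EnrichedFunctor Biset.{u} A B) {X Y Z : A} (f : Hom₁ X Y) (g : Hom₁ Y Z) :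
    map₁ F (comp₁ f g) = comp₁ (map₁ F f) (map₁ F g) :=
  congrFun (congrArg Biset.Hom.one (F.map_comp X Y Z)) (f, g)

theorem map_id₀ (F : EnrichedFunctor Biset.{u} A B) (X : A) : map₀ F (id₀ X) = id₀ (F.obj X) :=
  congrFun (congrArg Biset.Hom.zero (F.map_id X)) PUnit.unit

theorem map_id₁ (F : EnrichedFunctor Biset.{u} A B) (X : A) : map₁ F (id₁ X) = id₁ (F.obj X) :=
  congrFun (congrArg Biset.Hom.one (F.map_id X)) PUnit.unit

end FunctorCategories

section FunctorCategories

variable {A : Type u} [EnrichedCategory Biset.{u} A] {B : Type u₂} [EnrichedCategory Biset.{u} B]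
  {D : Type u₃} [EnrichedCategory Biset.{u} D]

/-- `F ⇒₀ G`: families `F X →₀ G X` that are natural with respect to all `X →₀ Y`. -/
@[ext]
structure Nat₀ (F G : EnrichedFunctor Biset.{u} A B) : Type u where
  app (X : A) : Hom₀ (F.obj X) (G.obj X)
  natural {X Y : A} (g : Hom₀ X Y) : comp₀ (map₀ F g) (app Y) = comp₀ (app X) (map₀ G g)

/-- `F ⇒₁ G`: families `F X →₁ G X` that are natural with respect to all `X →₁ Y` and whose
images under `φ` are natural with respect to all `X →₀ Y`. -/
@[ext]
structure Nat₁ (F G : EnrichedFunctor Biset.{u} A B) : Type u where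
  app (X : A) : Hom₁ (F.obj X) (G.obj X)
  natural₁ {X Y : A} (f : Hom₁ X Y) : comp₁ (map₁ F f) (app Y) = comp₁ (app X) (map₁ G f)
  natural₀ {X Y : A} (g : Hom₀ X Y) : comp₀ (map₀ F g) (app Y).φ = comp₀ (app X).φ (map₀ G g)

/-- The map `F ⇒₁ G → F ⇒₀ G`. -/
def Nat₁.toNat₀ {F G : EnrichedFunctor Biset.{u} A B} (α : Nat₁ F G) : Nat₀ F G :=
  ⟨fun X => (α.app X).φ, α.natural₀⟩

/-- The functor `Biset`-category `B^A`. -/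
instance functorEnriched : EnrichedCategory Biset.{u} (EnrichedFunctor Biset.{u} A B) where
  Hom F G := ⟨Nat₀ F G, Nat₁ F G, Nat₁.toNat₀⟩
  id F :=
    ⟨fun _ => ⟨fun X => id₀ (F.obj X), fun g => by rw [comp_id₀, id_comp₀]⟩,
      fun _ => ⟨fun X => id₁ (F.obj X), fun f => by rw [comp_id₁, id_comp₁],
        fun g => by rw [φ_id, φ_id, comp_id₀, id_comp₀]⟩,
      fun _ => Nat₀.ext (funext fun X => φ_id (F.obj X))⟩
  comp F G H :=
    ⟨fun p => ⟨fun X => comp₀ (p.1.app X) (p.2.app X), fun g => by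
        rw [← assoc₀, p.1.natural, assoc₀, p.2.natural, assoc₀]⟩,
      fun p => ⟨fun X => comp₁ (p.1.app X) (p.2.app X), fun f => by
        rw [← assoc₁, p.1.natural₁, assoc₁, p.2.natural₁, assoc₁], fun g => by
        rw [φ_comp, φ_comp, ← assoc₀, p.1.natural₀, assoc₀, p.2.natural₀, assoc₀]⟩,
      fun p => Nat₀.ext (funext fun X => φ_comp _ _)⟩
  id_comp F G := Biset.hom_ext (fun β => Nat₀.ext (funext fun X => id_comp₀ (β.app X)))
    (fun α => Nat₁.ext (funext fun X => id_comp₁ (α.app X)))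
  comp_id F G := Biset.hom_ext (fun β => Nat₀.ext (funext fun X => comp_id₀ (β.app X)))
    (fun α => Nat₁.ext (funext fun X => comp_id₁ (α.app X)))
  assoc F G H K :=
    Biset.hom_ext
      (fun p => Nat₀.ext (funext fun X => assoc₀ (p.1.app X) (p.2.1.app X) (p.2.2.app X)))
      (fun p => Nat₁.ext (funext fun X => assoc₁ (p.1.app X) (p.2.1.app X) (p.2.2.app X)))

/-- Postcomposition with a `Biset`-functor `H : B → D`, as a `Biset`-functor `B^A → D^A`. -/
def postcompose (H : EnrichedFunctor Biset.{u} B D) :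
    EnrichedFunctor Biset.{u} (EnrichedFunctor Biset.{u} A B) (EnrichedFunctor Biset.{u} A D) where
  obj F := F.comp Biset.{u} H
  map F G :=
    ⟨fun β => ⟨fun X => map₀ H (β.app X), fun {X Y} g => by
        refine (map_comp₀ H (map₀ F g) (β.app Y)).symm.trans ?_
        rw [β.natural, map_comp₀]
        rfl⟩,
      fun α => ⟨fun X => map₁ H (α.app X), fun {X Y} f => by
        refine (map_comp₁ H (map₁ F f) (α.app Y)).symm.trans ?_
        rw [α.natural₁, map_comp₁]
        rfl, fun {X Y} g => by
        change comp₀ (map₀ H (map₀ F g)) (map₁ H (α.app Y)).φ =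
          comp₀ (map₁ H (α.app X)).φ (map₀ H (map₀ G g))
        rw [φ_map, φ_map]
        refine (map_comp₀ H (map₀ F g) (α.app Y).φ).symm.trans ?_
        rw [α.natural₀, map_comp₀]⟩,
      fun α => Nat₀.ext (funext fun X => φ_map H (α.app X))⟩
  map_id F := Biset.hom_ext (fun _ => Nat₀.ext (funext fun X => map_id₀ H (F.obj X)))
    (fun _ => Nat₁.ext (funext fun X => map_id₁ H (F.obj X)))
  map_comp F G K :=
    Biset.hom_ext (fun p => Nat₀.ext (funext fun X => map_comp₀ H (p.1.app X) (p.2.app X)))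
      (fun p => Nat₁.ext (funext fun X => map_comp₁ H (p.1.app X) (p.2.app X)))

end FunctorCategories

/-- A symmetric monoidal category `M` with the same objects, tensor product of objects and tensor
unit as `Q`, together with a strict symmetric monoidal functor `J : M → Q` that is the identity on
objects. -/
structure Interpretation (Q : Type u) [Category.{u} Q] [MonoidalCategory Q]
    [SymmetricCategory Q] where
  Hom : Q → Q → Type u
  id (X : Q) : Hom X X
  comp {X Y Z : Q} : Hom X Y → Hom Y Z → Hom X Z
  id_comp {X Y : Q} (f : Hom X Y) : comp (id X) f = f
  comp_id {X Y : Q} (f : Hom X Y) : comp f (id Y) = f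
  assoc {W X Y Z : Q} (f : Hom W X) (g : Hom X Y) (h : Hom Y Z) :
    comp (comp f g) h = comp f (comp g h)
  tensor {X₁ Y₁ X₂ Y₂ : Q} : Hom X₁ Y₁ → Hom X₂ Y₂ → Hom (X₁ ⊗ X₂) (Y₁ ⊗ Y₂)
  tensor_id (X Y : Q) : tensor (id X) (id Y) = id (X ⊗ Y)
  tensor_comp {X₁ Y₁ Z₁ X₂ Y₂ Z₂ : Q} (f₁ : Hom X₁ Y₁) (f₂ : Hom X₂ Y₂)
    (g₁ : Hom Y₁ Z₁) (g₂ : Hom Y₂ Z₂) :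
    comp (tensor f₁ f₂) (tensor g₁ g₂) = tensor (comp f₁ g₁) (comp f₂ g₂)
  assocHom (X Y Z : Q) : Hom ((X ⊗ Y) ⊗ Z) (X ⊗ (Y ⊗ Z))
  assocInv (X Y Z : Q) : Hom (X ⊗ (Y ⊗ Z)) ((X ⊗ Y) ⊗ Z)
  assoc_hom_inv (X Y Z : Q) : comp (assocHom X Y Z) (assocInv X Y Z) = id _
  assoc_inv_hom (X Y Z : Q) : comp (assocInv X Y Z) (assocHom X Y Z) = id _
  leftHom (X : Q) : Hom (𝟙_ Q ⊗ X) X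
  leftInv (X : Q) : Hom X (𝟙_ Q ⊗ X)
  left_hom_inv (X : Q) : comp (leftHom X) (leftInv X) = id _
  left_inv_hom (X : Q) : comp (leftInv X) (leftHom X) = id _
  rightHom (X : Q) : Hom (X ⊗ 𝟙_ Q) X
  rightInv (X : Q) : Hom X (X ⊗ 𝟙_ Q)
  right_hom_inv (X : Q) : comp (rightHom X) (rightInv X) = id _
  right_inv_hom (X : Q) : comp (rightInv X) (rightHom X) = id _
  braid (X Y : Q) : Hom (X ⊗ Y) (Y ⊗ X)
  braid_braid (X Y : Q) : comp (braid X Y) (braid Y X) = id _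
  assoc_natural {X₁ Y₁ X₂ Y₂ X₃ Y₃ : Q} (f₁ : Hom X₁ Y₁) (f₂ : Hom X₂ Y₂) (f₃ : Hom X₃ Y₃) :
    comp (tensor (tensor f₁ f₂) f₃) (assocHom Y₁ Y₂ Y₃) =
      comp (assocHom X₁ X₂ X₃) (tensor f₁ (tensor f₂ f₃))
  left_natural {X Y : Q} (f : Hom X Y) :
    comp (tensor (id (𝟙_ Q)) f) (leftHom Y) = comp (leftHom X) f
  right_natural {X Y : Q} (f : Hom X Y) :
    comp (tensor f (id (𝟙_ Q))) (rightHom Y) = comp (rightHom X) f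
  braid_natural {X₁ Y₁ X₂ Y₂ : Q} (f₁ : Hom X₁ Y₁) (f₂ : Hom X₂ Y₂) :
    comp (tensor f₁ f₂) (braid Y₁ Y₂) = comp (braid X₁ X₂) (tensor f₂ f₁)
  pentagon (W X Y Z : Q) :
    comp (tensor (assocHom W X Y) (id Z))
        (comp (assocHom W (X ⊗ Y) Z) (tensor (id W) (assocHom X Y Z))) =
      comp (assocHom (W ⊗ X) Y Z) (assocHom W X (Y ⊗ Z))
  triangle (X Y : Q) :
    comp (assocHom X (𝟙_ Q) Y) (tensor (id X) (leftHom Y)) = tensor (rightHom X) (id Y)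
  hexagon (X Y Z : Q) :
    comp (assocHom X Y Z) (comp (braid X (Y ⊗ Z)) (assocHom Y Z X)) =
      comp (tensor (braid X Y) (id Z)) (comp (assocHom Y X Z) (tensor (id Y) (braid X Z)))
  J {X Y : Q} : Hom X Y → (X ⟶ Y)
  J_id (X : Q) : J (id X) = 𝟙 X
  J_comp {X Y Z : Q} (f : Hom X Y) (g : Hom Y Z) : J (comp f g) = J f ≫ J g
  J_tensor {X₁ Y₁ X₂ Y₂ : Q} (f : Hom X₁ Y₁) (g : Hom X₂ Y₂) : J (tensor f g) = J f ⊗ₘ J g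
  J_assoc (X Y Z : Q) : J (assocHom X Y Z) = (α_ X Y Z).hom
  J_left (X : Q) : J (leftHom X) = (λ_ X).hom
  J_right (X : Q) : J (rightHom X) = (ρ_ X).hom
  J_braid (X Y : Q) : J (braid X Y) = (β_ X Y).hom

section Model

variable {Q : Type u} [Category.{u} Q] [MonoidalCategory Q] [SymmetricCategory Q]

/-- The objects of `M` and of `C`: those of `Q`. -/
structure Interpretation.Obj (𝓜 : Interpretation Q) : Type u where
  ob : Q

namespace Interpretation

variable (𝓜 : Interpretation Q)

/-- The category `M`. -/
instance : Category.{u} 𝓜.Obj where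
  Hom X Y := 𝓜.Hom X.ob Y.ob
  id X := 𝓜.id X.ob
  comp f g := 𝓜.comp f g
  id_comp := 𝓜.id_comp
  comp_id := 𝓜.comp_id
  assoc := 𝓜.assoc

instance : MonoidalCategoryStruct 𝓜.Obj where
  tensorObj X Y := ⟨X.ob ⊗ Y.ob⟩
  tensorUnit := ⟨𝟙_ Q⟩
  tensorHom f g := 𝓜.tensor f g
  whiskerLeft X _ _ g := 𝓜.tensor (𝓜.id X.ob) g
  whiskerRight f Y := 𝓜.tensor f (𝓜.id Y.ob)
  associator X Y Z :=
    ⟨𝓜.assocHom X.ob Y.ob Z.ob, 𝓜.assocInv X.ob Y.ob Z.ob, 𝓜.assoc_hom_inv _ _ _,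
      𝓜.assoc_inv_hom _ _ _⟩
  leftUnitor X := ⟨𝓜.leftHom X.ob, 𝓜.leftInv X.ob, 𝓜.left_hom_inv _, 𝓜.left_inv_hom _⟩
  rightUnitor X := ⟨𝓜.rightHom X.ob, 𝓜.rightInv X.ob, 𝓜.right_hom_inv _, 𝓜.right_inv_hom _⟩

instance : MonoidalCategory 𝓜.Obj :=
  MonoidalCategory.ofTensorHom
    (id_tensorHom_id := fun X Y => 𝓜.tensor_id X.ob Y.ob)
    (id_tensorHom := fun _ _ _ _ => rfl)
    (tensorHom_id := fun _ _ => rfl)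
    (tensorHom_comp_tensorHom := fun f₁ f₂ g₁ g₂ => 𝓜.tensor_comp f₁ f₂ g₁ g₂)
    (associator_naturality := fun f₁ f₂ f₃ => 𝓜.assoc_natural f₁ f₂ f₃)
    (leftUnitor_naturality := fun f => 𝓜.left_natural f)
    (rightUnitor_naturality := fun f => 𝓜.right_natural f)
    (pentagon := fun W X Y Z => 𝓜.pentagon W.ob X.ob Y.ob Z.ob)
    (triangle := fun X Y => 𝓜.triangle X.ob Y.ob)

/-- The symmetry of `M`. -/
def braidIso (X Y : 𝓜.Obj) : X ⊗ Y ≅ Y ⊗ X where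
  hom := 𝓜.braid X.ob Y.ob
  inv := 𝓜.braid Y.ob X.ob
  hom_inv_id := 𝓜.braid_braid X.ob Y.ob
  inv_hom_id := 𝓜.braid_braid Y.ob X.ob

instance : SymmetricCategory 𝓜.Obj where
  braiding := 𝓜.braidIso
  braiding_naturality_right X _ _ f := 𝓜.braid_natural (𝓜.id X.ob) f
  braiding_naturality_left f Z := 𝓜.braid_natural f (𝓜.id Z.ob)
  hexagon_forward X Y Z := 𝓜.hexagon X.ob Y.ob Z.ob
  hexagon_reverse X Y Z := by
    have h : α_ Z X Y ≪≫ 𝓜.braidIso Z (X ⊗ Y) ≪≫ α_ X Y Z =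
        whiskerRightIso (𝓜.braidIso Z X) Y ≪≫ α_ X Z Y ≪≫ whiskerLeftIso X (𝓜.braidIso Z Y) :=
      Iso.ext (𝓜.hexagon Z.ob X.ob Y.ob)
    have h' := congrArg Iso.inv h
    simp only [Iso.trans_inv, whiskerRightIso_inv, whiskerLeftIso_inv, Category.assoc] at h'
    exact h'
  symmetry X Y := 𝓜.braid_braid X.ob Y.ob

/-- The interpretation functor `J : M ⥤ Q`. -/
def functor : 𝓜.Obj ⥤ Q where
  obj X := X.ob
  map f := 𝓜.J f
  map_id X := 𝓜.J_id X.ob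
  map_comp f g := 𝓜.J_comp f g

/-- The `Biset`-category `C`, with `C(X, Y) = (Q(X, Y), M(X, Y), J)`. -/
instance : EnrichedCategory Biset.{u} 𝓜.Obj where
  Hom X Y := ⟨X.ob ⟶ Y.ob, X ⟶ Y, fun f => 𝓜.functor.map f⟩
  id X := ⟨fun _ => 𝟙 X.ob, fun _ => 𝟙 X, fun _ => 𝓜.functor.map_id X⟩
  comp X Y Z := ⟨fun p => p.1 ≫ p.2, fun p => p.1 ≫ p.2, fun p => 𝓜.functor.map_comp p.1 p.2⟩
  id_comp X Y := Biset.hom_ext (fun f => Category.id_comp f) (fun f => Category.id_comp f)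
  comp_id X Y := Biset.hom_ext (fun f => Category.comp_id f) (fun f => Category.comp_id f)
  assoc W X Y Z := Biset.hom_ext (fun p => Category.assoc p.1 p.2.1 p.2.2)
    (fun p => Category.assoc p.1 p.2.1 p.2.2)

/-- The `Biset`-category `C̄` of `Biset`-functors `Cᵒᵖ → Biset`. -/
abbrev Psh : Type (u + 1) := EnrichedFunctor Biset.{u} 𝓜.Objᵒᵖ Biset.{u}

/-- The `Biset`-category of `Biset`-functors `Cᵒᵖ → Set`. -/
abbrev SetPsh : Type (u + 1) := EnrichedFunctor Biset.{u} 𝓜.Objᵒᵖ (Type u)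

variable {𝓜}

/-- The functor `F⁰ : Qᵒᵖ ⥤ Set`, `X ↦ (F X)₀`, of a `Biset`-functor `F : Cᵒᵖ → Biset`. -/
def Psh.zero (F : 𝓜.Psh) : Qᵒᵖ ⥤ Type u where
  obj X := (F.obj (op ⟨X.unop⟩)).zero
  map {X Y} g := ↾(map₀ F (X := op ⟨X.unop⟩) (Y := op ⟨Y.unop⟩) g.unop)
  map_id X := by
    ext x
    exact congrFun (map_id₀ F (op ⟨X.unop⟩)) x
  map_comp {X Y Z} f g := by
    ext x
    exact congrFun (map_comp₀ F (X := op ⟨X.unop⟩) (Y := op ⟨Y.unop⟩) (Z := op ⟨Z.unop⟩)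
      f.unop g.unop) x

/-- The functor `Mᵒᵖ ⥤ Set`, `X ↦ (F X)₁`, of a `Biset`-functor `F : Cᵒᵖ → Biset`. -/
def Psh.one (F : 𝓜.Psh) : 𝓜.Objᵒᵖ ⥤ Type u where
  obj X := (F.obj X).one
  map {X Y} f := ↾(Biset.Hom.one (map₁ F (X := X) (Y := Y) f.unop))
  map_id X := by
    ext x
    exact congrFun (congrArg Biset.Hom.one (map_id₁ F X)) x
  map_comp {X Y Z} f g := by
    ext x
    exact congrFun (congrArg Biset.Hom.one (map_comp₁ F (X := X) (Y := Y) (Z := Z)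
      f.unop g.unop)) x

/-- The functions `(F X)₁ → (F X)₀`, as a natural transformation. -/
def Psh.str (F : 𝓜.Psh) : F.one ⟶ 𝓜.functor.op ⋙ F.zero where
  app X := ↾(F.obj X).map
  naturality {X Y} f := by
    ext x
    exact (Biset.Hom.comm (map₁ F (X := X) (Y := Y) f.unop) x).trans
      (congrFun (φ_map F (X := X) (Y := Y) f.unop) ((F.obj X).map x))

/-- A `Biset`-functor `Cᵒᵖ → Biset` amounts to functors `Qᵒᵖ ⥤ Set` and `Mᵒᵖ ⥤ Set` and a natural
transformation between them. -/
def Psh.mk (P₀ : Qᵒᵖ ⥤ Type u) (P₁ : 𝓜.Objᵒᵖ ⥤ Type u) (h : P₁ ⟶ 𝓜.functor.op ⋙ P₀) :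
    𝓜.Psh where
  obj X := ⟨P₀.obj (op X.unop.ob), P₁.obj X, fun x => h.app X x⟩
  map X Y := ⟨fun g x => P₀.map (Quiver.Hom.op g) x, fun f =>
    ⟨fun x => P₀.map (𝓜.functor.map f).op x, fun x => P₁.map (Quiver.Hom.op f) x,
      fun x => ConcreteCategory.congr_hom (h.naturality (Quiver.Hom.op f)) x⟩, fun _ => rfl⟩
  map_id X :=
    Biset.hom_ext
      (fun _ => funext fun x => ConcreteCategory.congr_hom (P₀.map_id (op X.unop.ob)) x)
      (fun _ => Biset.hom_ext
        (fun x => (congrArg (fun k => P₀.map (Quiver.Hom.op k) x)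
          (𝓜.functor.map_id X.unop)).trans (ConcreteCategory.congr_hom (P₀.map_id (op X.unop.ob)) x))
        (fun x => ConcreteCategory.congr_hom (P₁.map_id X) x))
  map_comp X Y Z :=
    Biset.hom_ext
      (fun p => funext fun x => ConcreteCategory.congr_hom
        (P₀.map_comp (Quiver.Hom.op p.1) (Quiver.Hom.op p.2)) x)
      (fun p => Biset.hom_ext
        (fun x => (congrArg (fun k => P₀.map (Quiver.Hom.op k) x)
          (𝓜.functor.map_comp p.2 p.1)).trans (ConcreteCategory.congr_hom
            (P₀.map_comp (𝓜.functor.map p.1).op (𝓜.functor.map p.2).op) x))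
        (fun x => ConcreteCategory.congr_hom
          (P₁.map_comp (Quiver.Hom.op p.1) (Quiver.Hom.op p.2)) x))

end Interpretation

namespace Interpretation

variable {𝓜 : Interpretation Q}

/-- Elements of `F ⇒₀ G` are natural transformations `F⁰ → G⁰`. -/
def Psh.nat₀ {F G : 𝓜.Psh} (β : Nat₀ F G) : F.zero ⟶ G.zero where
  app X := ↾(β.app (op ⟨X.unop⟩))
  naturality X Y g := by
    ext x
    exact congrFun (β.natural (X := op ⟨X.unop⟩) (Y := op ⟨Y.unop⟩) g.unop) x

/-- The part of an element of `F ⇒₁ G` at level `1`. -/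
def Psh.nat₁ {F G : 𝓜.Psh} (α : Nat₁ F G) : F.one ⟶ G.one where
  app X := ↾(Biset.Hom.one (α.app X))
  naturality X Y f := by
    ext x
    exact congrFun (congrArg Biset.Hom.one (α.natural₁ (X := X) (Y := Y) f.unop)) x

/-- The converse of `Psh.nat₀`. -/
def Psh.ofNat₀ {F G : 𝓜.Psh} (n : F.zero ⟶ G.zero) : Nat₀ F G where
  app X := fun x => n.app (op X.unop.ob) x
  natural {X Y} g := funext fun x =>
    NatTrans.naturality_apply n (X := op X.unop.ob) (Y := op Y.unop.ob) (Quiver.Hom.op g) x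

/-- Elements of `F ⇒₁ G` amount to pairs of natural transformations, at levels `0` and `1`, that
are compatible with the structure maps of `F` and `G`. -/
def Psh.ofNat₁ {F G : 𝓜.Psh} (n₀ : F.zero ⟶ G.zero) (n₁ : F.one ⟶ G.one)
    (h : n₁ ≫ G.str = F.str ≫ Functor.whiskerLeft 𝓜.functor.op n₀) : Nat₁ F G where
  app X := ⟨fun x => n₀.app (op X.unop.ob) x, fun x => n₁.app X x,
    fun x => ConcreteCategory.congr_hom (NatTrans.congr_app h X) x⟩
  natural₁ {X Y} f := Biset.hom_ext
    (fun x => by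
      have e := NatTrans.naturality_apply n₀ (X := op X.unop.ob) (Y := op Y.unop.ob)
        (𝓜.functor.map f).op x
      have e₁ := congrFun (φ_map F (X := X) (Y := Y) f) x
      have e₂ := congrFun (φ_map G (X := X) (Y := Y) f) (n₀.app (op X.unop.ob) x)
      exact (congrArg (fun w => n₀.app (op Y.unop.ob) w) e₁).trans (e.trans e₂.symm))
    (fun x => NatTrans.naturality_apply n₁ (X := X) (Y := Y) (Quiver.Hom.op f) x)
  natural₀ {X Y} g := funext fun x =>
    NatTrans.naturality_apply n₀ (X := op X.unop.ob) (Y := op Y.unop.ob) (Quiver.Hom.op g) x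

theorem Psh.nat_comm {F G : 𝓜.Psh} (α : Nat₁ F G) :
    Psh.nat₁ α ≫ G.str = F.str ≫ Functor.whiskerLeft 𝓜.functor.op (Psh.nat₀ α.toNat₀) := by
  ext X x
  exact Biset.Hom.comm (α.app X) x

/-- The structure map of the Day convolution. -/
def dayStr (F G : 𝓜.Psh) : day F.one G.one ⟶ 𝓜.functor.op ⋙ day F.zero G.zero :=
  day.desc (Z := 𝓜.functor.op ⋙ day F.zero G.zero)
    (fun {c a b} f x y => DayObj.mk (P := F.zero) (R := G.zero) (c := c.ob) (a := a.ob)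
      (b := b.ob) (𝓜.functor.map f) (F.str.app (op a) x) (G.str.app (op b) y))
    (fun {c a a' b b'} f s t x y => by
      rw [NatTrans.naturality_apply, NatTrans.naturality_apply]
      refine Eq.trans ?_ (DayObj.glide (P := F.zero) (R := G.zero) (c := c.ob) (a := a.ob)
        (b := b.ob) (𝓜.functor.map f) (𝓜.functor.map s) (𝓜.functor.map t) _ _)
      refine congrArg (fun k => DayObj.mk (P := F.zero) (R := G.zero) (c := c.ob) (a := a'.ob)
        (b := b'.ob) k (F.str.app (op a') x) (G.str.app (op b') y)) ?_
      refine (𝓜.functor.map_comp f (s ⊗ₘ t)).trans ?_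
      exact congrArg (fun k => 𝓜.functor.map f ≫ k) (𝓜.J_tensor s t))
    (fun {c c' a b} g f x y => congrArg (fun k => DayObj.mk (P := F.zero) (R := G.zero)
        (c := c'.ob) (a := a.ob) (b := b.ob) k (F.str.app (op a) x) (G.str.app (op b) y))
      (𝓜.functor.map_comp g f))

/-- The Day convolution `(F ⊗ G)(c) = ∫^{a,b} C(c, a ⊗ b) × F a × G b` in `C̄`. Coends and products
of bisets are computed separately at the levels `0` (over `Q`) and `1` (over `M`). -/
def Psh.tensor (F G : 𝓜.Psh) : 𝓜.Psh :=
  Psh.mk (day F.zero G.zero) (day F.one G.one) (dayStr F G)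

theorem day_map_str {F F' G G' : 𝓜.Psh} (α : Nat₁ F F') (β : Nat₁ G G') :
    day.map (Psh.nat₁ α) (Psh.nat₁ β) ≫ dayStr F' G' =
      dayStr F G ≫ Functor.whiskerLeft 𝓜.functor.op
        (day.map (Psh.nat₀ α.toNat₀) (Psh.nat₀ β.toNat₀)) := by
  ext c q
  induction q using DayObj.ind with
  | h f x y =>
    rename_i a b
    have e₁ := Biset.Hom.comm (α.app (op a)) x
    have e₂ := Biset.Hom.comm (β.app (op b)) y
    exact congrArg₂ (fun v w => DayObj.mk (P := F'.zero) (R := G'.zero) (c := c.unop.ob)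
      (a := a.ob) (b := b.ob) (𝓜.functor.map f) v w) e₁ e₂

/-- The Day convolution on hom-objects. -/
def Psh.tensorHom (F₁ F₂ G₁ G₂ : 𝓜.Psh) :
    (F₁ ⟶[Biset.{u}] G₁) ⊗ (F₂ ⟶[Biset.{u}] G₂) ⟶
      (F₁.tensor F₂ ⟶[Biset.{u}] G₁.tensor G₂) :=
  ⟨fun p => Psh.ofNat₀ (F := F₁.tensor F₂) (G := G₁.tensor G₂)
      (day.map (Psh.nat₀ p.1) (Psh.nat₀ p.2)),
    fun p => Psh.ofNat₁ (F := F₁.tensor F₂) (G := G₁.tensor G₂)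
      (day.map (Psh.nat₀ (Nat₁.toNat₀ p.1)) (Psh.nat₀ (Nat₁.toNat₀ p.2)))
      (day.map (Psh.nat₁ p.1) (Psh.nat₁ p.2)) (day_map_str p.1 p.2),
    fun _ => rfl⟩

variable (𝓜) in
/-- The representable presheaf `y X = C(-, X)`. -/
def yonedaPsh (X : 𝓜.Obj) : 𝓜.Psh :=
  Psh.mk (yoneda.obj X.ob) (yoneda.obj X)
    { app := fun Y => ↾(fun f : Y.unop ⟶ X => (𝓜.functor.map f : Y.unop.ob ⟶ X.ob))
      naturality := fun Y Z g => by
        ext f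
        exact 𝓜.functor.map_comp g.unop f }

theorem J_whiskerRight {X Y : 𝓜.Obj} (f : X ⟶ Y) (Z : 𝓜.Obj) :
    𝓜.functor.map (f ▷ Z) = (𝓜.functor.map f ▷ Z.ob : X.ob ⊗ Z.ob ⟶ Y.ob ⊗ Z.ob) :=
  (𝓜.J_tensor f (𝓜.id Z.ob)).trans
    ((congrArg (fun k => 𝓜.J f ⊗ₘ k) (𝓜.J_id Z.ob)).trans (tensorHom_id _ _))

theorem J_whiskerLeft (X : 𝓜.Obj) {Y Z : 𝓜.Obj} (f : Y ⟶ Z) :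
    𝓜.functor.map (X ◁ f) = (X.ob ◁ 𝓜.functor.map f : X.ob ⊗ Y.ob ⟶ X.ob ⊗ Z.ob) :=
  (𝓜.J_tensor (𝓜.id X.ob) f).trans
    ((congrArg (fun k => k ⊗ₘ 𝓜.J f) (𝓜.J_id X.ob)).trans (id_tensorHom _ _))

theorem J_comp₂ {W X Y Z : 𝓜.Obj} (f : W ⟶ X) (g : X ⟶ Y) (h : Y ⟶ Z) {k : X.ob ⟶ Y.ob}
    {l : Y.ob ⟶ Z.ob} (hg : 𝓜.functor.map g = k) (hh : 𝓜.functor.map h = l) :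
    𝓜.functor.map (f ≫ g ≫ h) = (𝓜.functor.map f : W.ob ⟶ X.ob) ≫ k ≫ l := by
  subst hg hh
  exact (𝓜.functor.map_comp f (g ≫ h)).trans (congrArg (fun m => 𝓜.functor.map f ≫ m)
    (𝓜.functor.map_comp g h))

theorem day_assoc_str (F G H : 𝓜.Psh) :
    day.assoc F.one G.one H.one ≫ dayStr F (G.tensor H) =
      dayStr (F.tensor G) H ≫ Functor.whiskerLeft 𝓜.functor.op
        (day.assoc F.zero G.zero H.zero) := by
  ext c q
  induction q using DayObj.ind with
  | h f q z =>
    rename_i e b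
    induction q using DayObj.ind with
    | h g x y =>
      rename_i a d
      exact congrArg₂ (fun v w => DayObj.mk (P := F.zero) (R := day G.zero H.zero) (c := c.unop.ob)
          (a := a.ob) (b := d.ob ⊗ b.ob) v (F.str.app (op a) x)
          (DayObj.mk (P := G.zero) (R := H.zero) (c := d.ob ⊗ b.ob) (a := d.ob) (b := b.ob) w
            (G.str.app (op d) y) (H.str.app (op b) z)))
        (J_comp₂ f (g ▷ b) (α_ a d b).hom (J_whiskerRight g b) (𝓜.J_assoc a.ob d.ob b.ob))
        (𝓜.functor.map_id (d ⊗ b))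

theorem day_leftUnitor_str (F : 𝓜.Psh) :
    day.leftUnitor F.one ≫ F.str =
      dayStr (𝓜.yonedaPsh (𝟙_ 𝓜.Obj)) F ≫ Functor.whiskerLeft 𝓜.functor.op
        (day.leftUnitor F.zero) := by
  ext c q
  induction q using DayObj.ind with
  | h f i y =>
    rename_i a b
    refine (NatTrans.naturality_apply F.str _ y).trans ?_
    exact congrArg (fun k : c.unop.ob ⟶ b.ob => F.zero.map k.op (F.str.app (op b) y))
      (J_comp₂ f ((show a ⟶ 𝟙_ 𝓜.Obj from i) ▷ b) (λ_ b).hom (J_whiskerRight _ b)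
        (𝓜.J_left b.ob))

theorem day_rightUnitor_str (F : 𝓜.Psh) :
    day.rightUnitor F.one ≫ F.str =
      dayStr F (𝓜.yonedaPsh (𝟙_ 𝓜.Obj)) ≫ Functor.whiskerLeft 𝓜.functor.op
        (day.rightUnitor F.zero) := by
  ext c q
  induction q using DayObj.ind with
  | h f x i =>
    rename_i a b
    refine (NatTrans.naturality_apply F.str _ x).trans ?_
    exact congrArg (fun k : c.unop.ob ⟶ a.ob => F.zero.map k.op (F.str.app (op a) x))
      (J_comp₂ f (a ◁ (show b ⟶ 𝟙_ 𝓜.Obj from i)) (ρ_ a).hom (J_whiskerLeft a _)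
        (𝓜.J_right a.ob))

theorem day_braiding_str (F G : 𝓜.Psh) :
    day.braiding F.one G.one ≫ dayStr G F =
      dayStr F G ≫ Functor.whiskerLeft 𝓜.functor.op (day.braiding F.zero G.zero) := by
  ext c q
  induction q using DayObj.ind with
  | h f x y =>
    rename_i a b
    exact congrArg (fun k => DayObj.mk (P := G.zero) (R := F.zero) (c := c.unop.ob) (a := b.ob)
        (b := a.ob) k (G.str.app (op b) y) (F.str.app (op a) x))
      ((𝓜.functor.map_comp f (β_ a b).hom).trans
        (congrArg (fun k => 𝓜.functor.map f ≫ k) (𝓜.J_braid a.ob b.ob)))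

variable (𝓜) in
/-- The symmetric monoidal structure of `C̄` given by the Day convolution. -/
def dayTensor : TensorData Biset.{u} 𝓜.Psh where
  unit := 𝓜.yonedaPsh (𝟙_ 𝓜.Obj)
  obj := Psh.tensor
  hom := Psh.tensorHom
  assoc F G H := Biset.point (Psh.ofNat₁ (F := (F.tensor G).tensor H) (G := F.tensor (G.tensor H))
    (day.assoc F.zero G.zero H.zero) (day.assoc F.one G.one H.one) (day_assoc_str F G H))
  leftUnitor F := Biset.point (Psh.ofNat₁ (F := (𝓜.yonedaPsh (𝟙_ 𝓜.Obj)).tensor F) (G := F)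
    (day.leftUnitor F.zero) (day.leftUnitor F.one) (day_leftUnitor_str F))
  rightUnitor F := Biset.point (Psh.ofNat₁ (F := F.tensor (𝓜.yonedaPsh (𝟙_ 𝓜.Obj))) (G := F)
    (day.rightUnitor F.zero) (day.rightUnitor F.one) (day_rightUnitor_str F))
  braiding F G := Biset.point (Psh.ofNat₁ (F := F.tensor G) (G := G.tensor F)
    (day.braiding F.zero G.zero) (day.braiding F.one G.one) (day_braiding_str F G))

end Interpretation

namespace Interpretation

variable {𝓜 : Interpretation Q}

/-- A `Biset`-functor `F : Cᵒᵖ → Biset` is smooth if `F⁰ : Qᵒᵖ ⥤ Set` preserves binary products. -/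
def Psh.IsSmooth (F : 𝓜.Psh) : Prop := prodPreserving Q F.zero

variable (𝓜) in
/-- The full `Biset`-subcategory `C̃` of smooth functors. -/
abbrev Smooth : Type (u + 1) := FullSub (Psh.IsSmooth (𝓜 := 𝓜))

variable (𝓜) in
/-- The inclusion `i : C̃ → C̄`. -/
def incl : EnrichedFunctor Biset.{u} 𝓜.Smooth 𝓜.Psh := FullSub.incl _

/-- The functor `F⁰ : Qᵒᵖ ⥤ Set` of a `Biset`-functor `F : Cᵒᵖ → Set`. -/
def SetPsh.zero (F : 𝓜.SetPsh) : Qᵒᵖ ⥤ Type u where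
  obj X := F.obj (op ⟨X.unop⟩)
  map {X Y} g := ↾(map₀ F (X := op ⟨X.unop⟩) (Y := op ⟨Y.unop⟩) g.unop)
  map_id X := by
    ext x
    exact congrFun (map_id₀ F (op ⟨X.unop⟩)) x
  map_comp {X Y Z} f g := by
    ext x
    exact congrFun (map_comp₀ F (X := op ⟨X.unop⟩) (Y := op ⟨Y.unop⟩) (Z := op ⟨Z.unop⟩)
      f.unop g.unop) x

/-- Smoothness of a `Biset`-functor `Cᵒᵖ → Set`. -/
def SetPsh.IsSmooth (F : 𝓜.SetPsh) : Prop := prodPreserving Q F.zero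

variable (𝓜) in
/-- The full `Biset`-subcategory of smooth functors `Cᵒᵖ → Set`. -/
abbrev SetSmooth : Type (u + 1) := FullSub (SetPsh.IsSmooth (𝓜 := 𝓜))

variable (𝓜)

/-- `Ū₀`, composition with `U₀`. -/
def Ubar : EnrichedFunctor Biset.{u} 𝓜.Psh 𝓜.SetPsh := postcompose Biset.U₀

/-- `Δ̄`, composition with `Δ`. -/
def Deltabar : EnrichedFunctor Biset.{u} 𝓜.SetPsh 𝓜.Psh := postcompose Biset.Δ

/-- `T̄ = Δ̄ ∘ Ū₀`. -/
def Tbar : EnrichedFunctor Biset.{u} 𝓜.Psh 𝓜.Psh := 𝓜.Ubar.comp Biset.{u} 𝓜.Deltabar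

/-- The restriction `Ū₀'` of `Ū₀` to smooth functors. -/
def Utilde : EnrichedFunctor Biset.{u} 𝓜.Smooth 𝓜.SetSmooth :=
  FullSub.restrict 𝓜.Ubar (fun _ h => h)

/-- The restriction `Δ̄'` of `Δ̄` to smooth functors. -/
def Deltatilde : EnrichedFunctor Biset.{u} 𝓜.SetSmooth 𝓜.Smooth :=
  FullSub.restrict 𝓜.Deltabar (fun _ h => h)

/-- `T̃ = Δ̄' ∘ Ū₀'`. -/
def Ttilde : EnrichedFunctor Biset.{u} 𝓜.Smooth 𝓜.Smooth :=
  𝓜.Utilde.comp Biset.{u} 𝓜.Deltatilde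

/-- The unit of `T̄`, that is, of the adjunction of `Ū₀` and `Δ̄`: at `X` it is
`(id, F X) : F X → ((F X)₀, (F X)₀, id)`. -/
def etaBar (F : 𝓜.Psh) : EMap Biset.{u} F (𝓜.Tbar.obj F) :=
  Biset.point (X := F ⟶[Biset.{u}] 𝓜.Tbar.obj F)
    { app := fun X => ⟨fun x => x, (F.obj X).map, fun _ => rfl⟩
      natural₁ := fun {X Y} f => Biset.hom_ext (fun _ => rfl)
        (fun x => Biset.Hom.comm (map₁ F f) x)
      natural₀ := fun _ => rfl }

/-- The multiplication of `T̄`, induced by the counit `U₀ (Δ S) = S`. -/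
def muBar (F : 𝓜.Psh) : EMap Biset.{u} (𝓜.Tbar.obj (𝓜.Tbar.obj F)) (𝓜.Tbar.obj F) :=
  Biset.point (X := 𝓜.Tbar.obj (𝓜.Tbar.obj F) ⟶[Biset.{u}] 𝓜.Tbar.obj F)
    { app := fun X => ⟨fun x => x, fun x => x, fun _ => rfl⟩
      natural₁ := fun _ => rfl
      natural₀ := fun _ => rfl }

/-- The unit of `T̃`. -/
def etaTilde (F : 𝓜.Smooth) : EMap Biset.{u} F (𝓜.Ttilde.obj F) := 𝓜.etaBar F.obj

/-- The multiplication of `T̃`. -/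
def muTilde (F : 𝓜.Smooth) :
    EMap Biset.{u} (𝓜.Ttilde.obj (𝓜.Ttilde.obj F)) (𝓜.Ttilde.obj F) := 𝓜.muBar F.obj

/-- The isomorphism `β : i T̃ F → T̄ i F`; both sides are the same functor. -/
def beta (F : 𝓜.Smooth) :
    EMap Biset.{u} (𝓜.incl.obj (𝓜.Ttilde.obj F)) (𝓜.Tbar.obj (𝓜.incl.obj F)) :=
  eId Biset.{u} (𝓜.Tbar.obj F.obj)

/-- The inverse of `β`. -/
def betaInv (F : 𝓜.Smooth) :
    EMap Biset.{u} (𝓜.Tbar.obj (𝓜.incl.obj F)) (𝓜.incl.obj (𝓜.Ttilde.obj F)) :=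
  eId Biset.{u} (𝓜.Tbar.obj F.obj)

/-- The strength `t̄ : F ⊗ T̄ G → T̄ (F ⊗ G)`: the composite of
`∫ t : ∫^{a,b} C(c, a ⊗ b) × F a × T (G b) → ∫^{a,b} T (C(c, a ⊗ b) × F a × G b)` and the canonical
map to `T ∫^{a,b} C(c, a ⊗ b) × F a × G b`, where `t` is the strength of the monad `T = Δ U₀` on
bisets. -/
def tBar (F G : 𝓜.Psh) :
    EMap Biset.{u} (𝓜.dayTensor.obj F (𝓜.Tbar.obj G)) (𝓜.Tbar.obj (𝓜.dayTensor.obj F G)) :=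
  Biset.point (Psh.ofNat₁ (F := F.tensor (𝓜.Tbar.obj G)) (G := 𝓜.Tbar.obj (F.tensor G))
    (𝟙 (day F.zero G.zero)) (dayStr F (𝓜.Tbar.obj G)) rfl)

variable {𝓜}

/-- `i L̃ F`, given by `(L̃ F)(X) = ((i L F⁰) X, (F X)₁, η ∘ F X)`. -/
noncomputable def Psh.reflect (F : 𝓜.Psh) : 𝓜.Psh :=
  Psh.mk (refl₀.obj F.zero) F.one
    (F.str ≫ Functor.whiskerLeft 𝓜.functor.op (reflUnit₀ F.zero))

theorem reflect_str {F G : 𝓜.Psh} (α : Nat₁ F G) :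
    Psh.nat₁ α ≫ G.str ≫ Functor.whiskerLeft 𝓜.functor.op (reflUnit₀ G.zero) =
      (F.str ≫ Functor.whiskerLeft 𝓜.functor.op (reflUnit₀ F.zero)) ≫
        Functor.whiskerLeft 𝓜.functor.op (refl₀.map (Psh.nat₀ α.toNat₀)) := by
  have h := reflectorAdj.unit.naturality (Psh.nat₀ α.toNat₀)
  rw [← Category.assoc, Psh.nat_comm, Category.assoc, Category.assoc,
    ← Functor.whiskerLeft_comp, ← Functor.whiskerLeft_comp]
  exact congrArg (fun k => F.str ≫ Functor.whiskerLeft 𝓜.functor.op k) h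

variable (𝓜) in
/-- The reflection `L̃ : C̄ → C̃`. -/
noncomputable def Ltilde : EnrichedFunctor Biset.{u} 𝓜.Psh 𝓜.Smooth where
  obj F := ⟨F.reflect, (reflector.obj F.zero).property⟩
  map F G :=
    ⟨fun β => Psh.ofNat₀ (F := F.reflect) (G := G.reflect) (refl₀.map (Psh.nat₀ β)),
      fun α => Psh.ofNat₁ (F := F.reflect) (G := G.reflect)
        (refl₀.map (Psh.nat₀ (Nat₁.toNat₀ α))) (Psh.nat₁ (F := F) (G := G) α) (reflect_str α), fun _ => rfl⟩
  map_id F :=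
    Biset.hom_ext
      (fun _ => Nat₀.ext (funext fun X => funext fun x => ConcreteCategory.congr_hom
        (NatTrans.congr_app (refl₀.map_id F.zero) (op X.unop.ob)) x))
      (fun _ => Nat₁.ext (funext fun X => Biset.hom_ext
        (fun x => ConcreteCategory.congr_hom
          (NatTrans.congr_app (refl₀.map_id F.zero) (op X.unop.ob)) x)
        (fun _ => rfl)))
  map_comp F G H :=
    Biset.hom_ext
      (fun p => Nat₀.ext (funext fun X => funext fun x => ConcreteCategory.congr_hom
        (NatTrans.congr_app (refl₀.map_comp (Psh.nat₀ p.1) (Psh.nat₀ p.2)) (op X.unop.ob)) x))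
      (fun p => Nat₁.ext (funext fun X => Biset.hom_ext
        (fun x => ConcreteCategory.congr_hom (NatTrans.congr_app
          (refl₀.map_comp (Psh.nat₀ (Nat₁.toNat₀ p.1)) (Psh.nat₀ (Nat₁.toNat₀ p.2)))
            (op X.unop.ob)) x)
        (fun _ => rfl)))

variable (𝓜) in
/-- The unit `η : F → i L̃ F`. -/
noncomputable def unitL (F : 𝓜.Psh) : EMap Biset.{u} F (𝓜.incl.obj (𝓜.Ltilde.obj F)) :=
  Biset.point (Psh.ofNat₁ (F := F) (G := F.reflect) (reflUnit₀ F.zero) (𝟙 F.one)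
    (Category.id_comp _))

theorem liftL_str {F : 𝓜.Psh} {G : 𝓜.Smooth} (α : Nat₁ F G.obj) :
    Psh.nat₁ α ≫ G.obj.str =
      (F.str ≫ Functor.whiskerLeft 𝓜.functor.op (reflUnit₀ F.zero)) ≫
        Functor.whiskerLeft 𝓜.functor.op (reflLift₀ G.prop (Psh.nat₀ α.toNat₀)) := by
  rw [Psh.nat_comm, Category.assoc, ← Functor.whiskerLeft_comp]
  exact congrArg (fun k => F.str ≫ Functor.whiskerLeft 𝓜.functor.op k)
    (reflLift₀_fac G.prop (Psh.nat₀ α.toNat₀)).symm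

/-- The map `L̃ F → G` corresponding to a map `F → i G`. -/
noncomputable def liftL {F : 𝓜.Psh} {G : 𝓜.Smooth} (α : Nat₁ F G.obj) :
    EMap Biset.{u} (𝓜.Ltilde.obj F) G :=
  Biset.point (X := F.reflect ⟶[Biset.{u}] G.obj)
    (Psh.ofNat₁ (F := F.reflect) (G := G.obj) (reflLift₀ G.prop (Psh.nat₀ α.toNat₀))
      (Psh.nat₁ (F := F) (G := G.obj) α) (liftL_str α))

variable (𝓜) in
/-- The counit `ε : L̃ i F → F`. -/
noncomputable def counitL (F : 𝓜.Smooth) : EMap Biset.{u} (𝓜.Ltilde.obj (𝓜.incl.obj F)) F :=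
  liftL (id₁ F.obj)

theorem extendL_str [∀ X : Q, PreservesColimitsOfShape (Discrete WalkingPair) (tensorRight X)]
    {F H : 𝓜.Psh} {G : 𝓜.Smooth} (α : Nat₁ (F.tensor H) G.obj) :
    (show day F.one H.one ⟶ G.obj.one from Psh.nat₁ (F := F.tensor H) (G := G.obj) α) ≫
        G.obj.str =
      dayStr F.reflect H ≫ Functor.whiskerLeft 𝓜.functor.op
        (dayExtend (P := F.zero) (S := H.zero) G.prop (Psh.nat₀ α.toNat₀)) := by
  refine (Psh.nat_comm α).trans ?_
  ext c q
  induction q using DayObj.ind with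
  | h f x y =>
    rename_i a b
    exact (ConcreteCategory.congr_hom (NatTrans.congr_app (dayExtend_fac (P := F.zero)
      (S := H.zero) G.prop (Psh.nat₀ α.toNat₀)) (op c.unop.ob))
      (DayObj.mk (P := F.zero) (R := H.zero) (c := c.unop.ob) (a := a.ob) (b := b.ob)
        (𝓜.functor.map f) (F.str.app (op a) x) (H.str.app (op b) y))).symm

/-- The extension `i L̃ F ⊗ H → i G` of a map `F ⊗ H → i G` along the unit `F → i L̃ F`. -/
noncomputable def extendL
    [∀ X : Q, PreservesColimitsOfShape (Discrete WalkingPair) (tensorRight X)]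
    {F H : 𝓜.Psh} {G : 𝓜.Smooth} (α : Nat₁ (F.tensor H) G.obj) :
    Nat₁ (F.reflect.tensor H) G.obj :=
  Psh.ofNat₁ (F := F.reflect.tensor H) (G := G.obj) (dayExtend G.prop (Psh.nat₀ α.toNat₀))
    (Psh.nat₁ (F := F.tensor H) (G := G.obj) α) (extendL_str α)

theorem yonedaPsh_isSmooth (X : 𝓜.Obj) : (𝓜.yonedaPsh X).IsSmooth :=
  inferInstanceAs (PreservesLimitsOfShape (Discrete WalkingPair) (yoneda.obj X.ob))

variable (𝓜) in
/-- The symmetric monoidal structure of `C̃`: `F ⊗ G = L̃ (i F ⊗ i G)`, with unit `y I`. The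
associator is the unique map whose composite with the isomorphism
`L̃ (η ⊗ i H) : L̃ ((i F ⊗ i G) ⊗ i H) → L̃ (i L̃ (i F ⊗ i G) ⊗ i H)` is the composite of `L̃ α` with
`L̃ (i F ⊗ η)`. -/
noncomputable def lamTensor
    [∀ X : Q, PreservesColimitsOfShape (Discrete WalkingPair) (tensorRight X)] :
    TensorData Biset.{u} 𝓜.Smooth where
  unit := ⟨𝓜.yonedaPsh (𝟙_ 𝓜.Obj), yonedaPsh_isSmooth _⟩
  obj F G := 𝓜.Ltilde.obj (𝓜.dayTensor.obj (𝓜.incl.obj F) (𝓜.incl.obj G))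
  hom F₁ F₂ G₁ G₂ := 𝓜.dayTensor.hom F₁.obj F₂.obj G₁.obj G₂.obj ≫ 𝓜.Ltilde.map _ _
  assoc F G H := liftL (extendL (F := F.obj.tensor G.obj) (H := H.obj)
    (G := 𝓜.Ltilde.obj (F.obj.tensor (G.obj.tensor H.obj).reflect))
    (Biset.Hom.one
      (((𝓜.dayTensor.assoc F.obj G.obj H.obj).comp
        (𝓜.dayTensor.tensorMap (eId _ F.obj) (𝓜.unitL (𝓜.dayTensor.obj G.obj H.obj)))).comp
        (𝓜.unitL _)) PUnit.unit))
  leftUnitor F := ((𝓜.dayTensor.leftUnitor F.obj).image 𝓜.Ltilde).comp (𝓜.counitL F)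
  rightUnitor F := ((𝓜.dayTensor.rightUnitor F.obj).image 𝓜.Ltilde).comp (𝓜.counitL F)
  braiding F G := (𝓜.dayTensor.braiding F.obj G.obj).image 𝓜.Ltilde

variable (𝓜) in
/-- `ρ : L̃ T̄ F → T̃ L̃ F`. -/
noncomputable def rho (F : 𝓜.Psh) :
    EMap Biset.{u} (𝓜.Ltilde.obj (𝓜.Tbar.obj F)) (𝓜.Ttilde.obj (𝓜.Ltilde.obj F)) :=
  ((((𝓜.unitL F).image 𝓜.Tbar).image 𝓜.Ltilde).comp
    ((𝓜.betaInv (𝓜.Ltilde.obj F)).image 𝓜.Ltilde)).comp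
      (𝓜.counitL (𝓜.Ttilde.obj (𝓜.Ltilde.obj F)))

variable (𝓜) in
/-- The strength `t̃ : F ⊗ T̃ G → T̃ (F ⊗ G)` of `T̃`, that is, `ρ ∘ L̃ t̄ ∘ L̃ (i F ⊗ β)`. -/
noncomputable def tTilde
    [∀ X : Q, PreservesColimitsOfShape (Discrete WalkingPair) (tensorRight X)]
    (F G : 𝓜.Smooth) :
    EMap Biset.{u} (𝓜.lamTensor.obj F (𝓜.Ttilde.obj G)) (𝓜.Ttilde.obj (𝓜.lamTensor.obj F G)) :=
  (((𝓜.dayTensor.tensorMap (eId _ (𝓜.incl.obj F)) (𝓜.beta G)).image 𝓜.Ltilde).comp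
    ((𝓜.tBar (𝓜.incl.obj F) (𝓜.incl.obj G)).image 𝓜.Ltilde)).comp
      (𝓜.rho (𝓜.dayTensor.obj (𝓜.incl.obj F) (𝓜.incl.obj G)))

end Interpretation

end Model

/-!
The Day convolution is generated by pure tensors `x ⊗ y`, and so is its reflection as far as maps
into product preserving presheaves are concerned. Because `⊗` distributes over the coproducts of
`Q`, the product preserving presheaves are closed under the shifts `Z(- ⊗ b)` and `Z(a ⊗ -)`, so
iterated tensor products are generated by iterated pure tensors. On these, each coherence law is an
instance of the same law in `M` or in `Q`.

The structure map `(T̃F)¹ → (T̃F)⁰` is an identity, so a map into `T̃F` is determined by its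
component at level `0`. There `T̃`, `η̃`, `μ̃`, `t̃` and the costrength are all identities (the last
because the symmetry is an involution), and the laws of a commutative strong monad reduce to
functoriality of `⊗`.
-/

section SymmetricCategory

variable {K : Type u₁} [Category.{v} K] [MonoidalCategory K] [SymmetricCategory K]

theorem braiding_conj_associator (a b c : K) :
    (β_ a (b ⊗ c)).hom ≫ (β_ b c).hom ▷ a ≫ (α_ c b a).hom ≫ c ◁ (β_ b a).hom ≫
      (β_ c (a ⊗ b)).hom = (α_ a b c).inv := by
  calc _ = a ◁ (β_ b c).hom ≫ (β_ a (c ⊗ b)).hom ≫ (α_ c b a).hom ≫ c ◁ (β_ b a).hom ≫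
          (β_ c (a ⊗ b)).hom := by rw [BraidedCategory.braiding_naturality_right_assoc]
    _ = a ◁ (β_ b c).hom ≫ (α_ a c b).inv ≫ (β_ a c).hom ▷ b ≫ (α_ c a b).hom ≫
          (β_ c (a ⊗ b)).hom := by
        simp [← MonoidalCategory.whiskerLeft_comp_assoc, -BraidedCategory.braiding_tensor_left_hom]
    _ = (α_ a b c).inv ≫ (β_ (a ⊗ b) c).hom ≫ (β_ c (a ⊗ b)).hom := by
        simp only [BraidedCategory.braiding_tensor_left_hom, Category.assoc, Iso.inv_hom_id_assoc]
    _ = (α_ a b c).inv := by rw [SymmetricCategory.symmetry, Category.comp_id]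

end SymmetricCategory

/-- A tensor product of presheaves of sets on a monoidal category that is generated by pure tensors
as far as maps into the presheaves satisfying `mem` are concerned. These contain the tensor products
and are closed under the shifts `Z(- ⊗ b)` and `Z(a ⊗ -)`, so that maps out of iterated tensor
products can be compared one variable at a time. -/
structure PresheafTensor (K : Type u) [Category.{u} K] [MonoidalCategory K] where
  mem : ObjectProperty (Kᵒᵖ ⥤ Type u)
  mem_shiftRight {Z : Kᵒᵖ ⥤ Type u} (b : K) : mem Z → mem ((tensorRight b).op ⋙ Z)
  mem_shiftLeft {Z : Kᵒᵖ ⥤ Type u} (a : K) : mem Z → mem ((tensorLeft a).op ⋙ Z)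
  obj (P R : Kᵒᵖ ⥤ Type u) : Kᵒᵖ ⥤ Type u
  obj_mem (P R : Kᵒᵖ ⥤ Type u) : mem (obj P R)
  pure {P R : Kᵒᵖ ⥤ Type u} {a b : K} (x : P.obj (op a)) (y : R.obj (op b)) :
    (obj P R).obj (op (a ⊗ b))
  map_pure {P R : Kᵒᵖ ⥤ Type u} {a a' b b' : K} (s : a ⟶ a') (t : b ⟶ b') (x : P.obj (op a'))
    (y : R.obj (op b')) :
    (obj P R).map (s ⊗ₘ t).op (pure x y) = pure (P.map s.op x) (R.map t.op y)
  hom_ext {P R Z : Kᵒᵖ ⥤ Type u} (hZ : mem Z) {f g : obj P R ⟶ Z}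
    (h : ∀ {a b : K} (x : P.obj (op a)) (y : R.obj (op b)),
      f.app (op (a ⊗ b)) (pure x y) = g.app (op (a ⊗ b)) (pure x y)) : f = g

namespace PresheafTensor

variable {K : Type u} [Category.{u} K] [MonoidalCategory K] (T : PresheafTensor K)
  {P R S U Z : Kᵒᵖ ⥤ Type u}

theorem pure_map_left {a a' b : K} (s : a ⟶ a') (x : P.obj (op a')) (y : R.obj (op b)) :
    T.pure (P.map s.op x) y = (T.obj P R).map (s ▷ b).op (T.pure x y) := by
  rw [← tensorHom_id, T.map_pure, op_id, Functor.map_id_apply]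

theorem pure_map_right {a b b' : K} (t : b ⟶ b') (x : P.obj (op a)) (y : R.obj (op b')) :
    T.pure x (R.map t.op y) = (T.obj P R).map (a ◁ t).op (T.pure x y) := by
  rw [← id_tensorHom, T.map_pure, op_id, Functor.map_id_apply]

/-- The map `x ↦ f (x ⊗ y)` for a fixed `y`. -/
def evalRight (f : T.obj P R ⟶ Z) {b : K} (y : R.obj (op b)) : P ⟶ (tensorRight b).op ⋙ Z where
  app a := ↾(fun x => f.app (op (a.unop ⊗ b)) (T.pure x y))
  naturality a a' s := by
    ext x
    exact (congrArg (f.app (op (a'.unop ⊗ b))) (T.pure_map_left s.unop x y)).trans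
      (NatTrans.naturality_apply f (s.unop ▷ b).op _)

/-- The map `y ↦ f (x ⊗ y)` for a fixed `x`. -/
def evalLeft (f : T.obj P R ⟶ Z) {a : K} (x : P.obj (op a)) : R ⟶ (tensorLeft a).op ⋙ Z where
  app b := ↾(fun y => f.app (op (a ⊗ b.unop)) (T.pure x y))
  naturality b b' t := by
    ext y
    exact (congrArg (f.app (op (a ⊗ b'.unop))) (T.pure_map_right t.unop x y)).trans
      (NatTrans.naturality_apply f (a ◁ t.unop).op _)

theorem hom_ext_evalRight (hZ : T.mem Z) {f g : T.obj P R ⟶ Z}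
    (h : ∀ {b : K} (y : R.obj (op b)), T.evalRight f y = T.evalRight g y) : f = g :=
  T.hom_ext hZ (fun {a _} x y => ConcreteCategory.congr_hom (NatTrans.congr_app (h y) (op a)) x)

theorem hom_ext_evalLeft (hZ : T.mem Z) {f g : T.obj P R ⟶ Z}
    (h : ∀ {a : K} (x : P.obj (op a)), T.evalLeft f x = T.evalLeft g x) : f = g :=
  T.hom_ext hZ (fun {_ b} x y => ConcreteCategory.congr_hom (NatTrans.congr_app (h x) (op b)) y)

theorem hom_ext₃ (hZ : T.mem Z) {f g : T.obj (T.obj P R) S ⟶ Z}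
    (h : ∀ {a b c : K} (x : P.obj (op a)) (y : R.obj (op b)) (z : S.obj (op c)),
      f.app (op ((a ⊗ b) ⊗ c)) (T.pure (T.pure x y) z) =
        g.app (op ((a ⊗ b) ⊗ c)) (T.pure (T.pure x y) z)) : f = g :=
  T.hom_ext_evalRight hZ (fun {c} z => T.hom_ext (T.mem_shiftRight c hZ) (fun x y => h x y z))

theorem hom_ext₃_right (hZ : T.mem Z) {f g : T.obj P (T.obj R S) ⟶ Z}
    (h : ∀ {a b c : K} (x : P.obj (op a)) (y : R.obj (op b)) (z : S.obj (op c)),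
      f.app (op (a ⊗ (b ⊗ c))) (T.pure x (T.pure y z)) =
        g.app (op (a ⊗ (b ⊗ c))) (T.pure x (T.pure y z))) : f = g :=
  T.hom_ext_evalLeft hZ (fun {a} x => T.hom_ext (T.mem_shiftLeft a hZ) (fun y z => h x y z))

theorem hom_ext₄ (hZ : T.mem Z) {f g : T.obj (T.obj (T.obj P R) S) U ⟶ Z}
    (h : ∀ {a b c d : K} (x : P.obj (op a)) (y : R.obj (op b)) (z : S.obj (op c))
      (w : U.obj (op d)),
      f.app (op (((a ⊗ b) ⊗ c) ⊗ d)) (T.pure (T.pure (T.pure x y) z) w) =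
        g.app (op (((a ⊗ b) ⊗ c) ⊗ d)) (T.pure (T.pure (T.pure x y) z) w)) : f = g :=
  T.hom_ext_evalRight hZ
    (fun {d} w => T.hom_ext₃ (T.mem_shiftRight d hZ) (fun x y z => h x y z w))

end PresheafTensor

/-- A tensor product of presheaves together with the structure maps of a symmetric monoidal
category, specified by their values on pure tensors. The unitors are only required at the presheaves
satisfying `mem`. -/
structure SymmetricPresheafTensor (K : Type u) [Category.{u} K] [MonoidalCategory K]
    [SymmetricCategory K] extends PresheafTensor K where
  map {P P' R R' : Kᵒᵖ ⥤ Type u} (m : P ⟶ P') (n : R ⟶ R') : obj P R ⟶ obj P' R'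
  assoc (P R S : Kᵒᵖ ⥤ Type u) : obj (obj P R) S ⟶ obj P (obj R S)
  leftUnitor {P : Kᵒᵖ ⥤ Type u} (hP : mem P) : obj (yoneda.obj (𝟙_ K)) P ⟶ P
  rightUnitor {P : Kᵒᵖ ⥤ Type u} (hP : mem P) : obj P (yoneda.obj (𝟙_ K)) ⟶ P
  braiding (P R : Kᵒᵖ ⥤ Type u) : obj P R ⟶ obj R P
  map_app_pure {P P' R R' : Kᵒᵖ ⥤ Type u} (m : P ⟶ P') (n : R ⟶ R') {a b : K}
    (x : P.obj (op a)) (y : R.obj (op b)) :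
    (map m n).app (op (a ⊗ b)) (pure x y) = pure (m.app (op a) x) (n.app (op b) y)
  assoc_app_pure {P R S : Kᵒᵖ ⥤ Type u} {a b c : K} (x : P.obj (op a)) (y : R.obj (op b))
    (z : S.obj (op c)) :
    (assoc P R S).app (op ((a ⊗ b) ⊗ c)) (pure (pure x y) z) =
      (obj P (obj R S)).map (α_ a b c).hom.op (pure x (pure y z))
  leftUnitor_app_pure {P : Kᵒᵖ ⥤ Type u} (hP : mem P) {a b : K}
    (i : (yoneda.obj (𝟙_ K)).obj (op a)) (y : P.obj (op b)) :
    (leftUnitor hP).app (op (a ⊗ b)) (pure i y) = P.map (i ▷ b ≫ (λ_ b).hom).op y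
  rightUnitor_app_pure {P : Kᵒᵖ ⥤ Type u} (hP : mem P) {a b : K} (x : P.obj (op a))
    (i : (yoneda.obj (𝟙_ K)).obj (op b)) :
    (rightUnitor hP).app (op (a ⊗ b)) (pure x i) = P.map (a ◁ i ≫ (ρ_ a).hom).op x
  braiding_app_pure {P R : Kᵒᵖ ⥤ Type u} {a b : K} (x : P.obj (op a)) (y : R.obj (op b)) :
    (braiding P R).app (op (a ⊗ b)) (pure x y) = (obj R P).map (β_ a b).hom.op (pure y x)

namespace SymmetricPresheafTensor

variable {K : Type u} [Category.{u} K] [MonoidalCategory K] [SymmetricCategory K]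
  (T : SymmetricPresheafTensor K) {P P' P'' R R' R'' S S' : Kᵒᵖ ⥤ Type u}

theorem map_id (P R : Kᵒᵖ ⥤ Type u) : T.map (𝟙 P) (𝟙 R) = 𝟙 (T.obj P R) :=
  T.hom_ext (T.obj_mem _ _) (T.map_app_pure _ _)

theorem map_comp (m : P ⟶ P') (m' : P' ⟶ P'') (n : R ⟶ R') (n' : R' ⟶ R'') :
    T.map (m ≫ m') (n ≫ n') = T.map m n ≫ T.map m' n' := by
  refine T.hom_ext (T.obj_mem _ _) (fun x y => ?_)
  simp only [NatTrans.comp_app_apply, T.map_app_pure]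

theorem assoc_natural (m : P ⟶ P') (n : R ⟶ R') (k : S ⟶ S') :
    T.map (T.map m n) k ≫ T.assoc P' R' S' = T.assoc P R S ≫ T.map m (T.map n k) := by
  refine T.hom_ext₃ (T.obj_mem _ _) (fun x y z => ?_)
  simp only [NatTrans.comp_app_apply, T.map_app_pure, T.assoc_app_pure, NatTrans.naturality_apply]

theorem leftUnitor_natural (hP : T.mem P) (hR : T.mem R) (m : P ⟶ R) :
    T.map (𝟙 _) m ≫ T.leftUnitor hR = T.leftUnitor hP ≫ m := by
  refine T.hom_ext hR (fun i y => ?_)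
  simp only [NatTrans.comp_app_apply, T.map_app_pure, T.leftUnitor_app_pure,
    NatTrans.naturality_apply, NatTrans.id_app, id_apply]

theorem braiding_natural (m : P ⟶ P') (n : R ⟶ R') :
    T.map m n ≫ T.braiding P' R' = T.braiding P R ≫ T.map n m := by
  refine T.hom_ext (T.obj_mem _ _) (fun x y => ?_)
  simp only [NatTrans.comp_app_apply, T.map_app_pure, T.braiding_app_pure,
    NatTrans.naturality_apply]

theorem braiding_leftUnitor (hP : T.mem P) :
    T.braiding P _ ≫ T.leftUnitor hP = T.rightUnitor hP := by
  refine T.hom_ext hP (fun {a b} x i => ?_)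
  simp only [NatTrans.comp_app_apply, T.braiding_app_pure, T.leftUnitor_app_pure,
    T.rightUnitor_app_pure, NatTrans.naturality_apply, ← Functor.map_comp_apply, ← op_comp]
  rw [← CategoryTheory.braiding_leftUnitor, BraidedCategory.braiding_naturality_right_assoc]

theorem rightUnitor_natural (hP : T.mem P) (hR : T.mem R) (m : P ⟶ R) :
    T.map m (𝟙 _) ≫ T.rightUnitor hR = T.rightUnitor hP ≫ m := by
  simp only [← T.braiding_leftUnitor, ← Category.assoc, T.braiding_natural]
  simp only [Category.assoc, T.leftUnitor_natural hP hR]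

theorem symmetry (P R : Kᵒᵖ ⥤ Type u) : T.braiding P R ≫ T.braiding R P = 𝟙 (T.obj P R) := by
  refine T.hom_ext (T.obj_mem _ _) (fun x y => ?_)
  simp only [NatTrans.comp_app_apply, T.braiding_app_pure, NatTrans.naturality_apply,
    ← Functor.map_comp_apply, ← op_comp, SymmetricCategory.symmetry, op_id, Functor.map_id_apply,
    NatTrans.id_app, id_apply]

theorem pentagon (P R S U : Kᵒᵖ ⥤ Type u) :
    (T.map (T.assoc P R S) (𝟙 U) ≫ T.assoc P (T.obj R S) U) ≫ T.map (𝟙 P) (T.assoc R S U) =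
      T.assoc (T.obj P R) S U ≫ T.assoc P R (T.obj S U) := by
  refine T.hom_ext₄ (T.obj_mem _ _) (fun x y z w => ?_)
  simp only [NatTrans.comp_app_apply, T.map_app_pure, T.assoc_app_pure, NatTrans.naturality_apply,
    T.pure_map_left, T.pure_map_right, NatTrans.id_app, id_apply, ← Functor.map_comp_apply,
    ← op_comp, MonoidalCategory.pentagon, Category.assoc]

theorem triangle (hP : T.mem P) (hR : T.mem R) :
    T.assoc P (yoneda.obj (𝟙_ K)) R ≫ T.map (𝟙 P) (T.leftUnitor hR) =
      T.map (T.rightUnitor hP) (𝟙 R) := by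
  refine T.hom_ext₃ (T.obj_mem _ _) (fun {a b c} x i z => ?_)
  simp only [NatTrans.comp_app_apply, T.map_app_pure, T.assoc_app_pure, NatTrans.naturality_apply,
    NatTrans.id_app, id_apply, T.leftUnitor_app_pure, T.rightUnitor_app_pure, T.pure_map_left,
    T.pure_map_right, ← Functor.map_comp_apply, ← op_comp]
  simp

theorem hexagon (P R S : Kᵒᵖ ⥤ Type u) :
    (T.assoc P R S ≫ T.braiding P (T.obj R S)) ≫ T.assoc R S P =
      (T.map (T.braiding P R) (𝟙 S) ≫ T.assoc R P S) ≫ T.map (𝟙 R) (T.braiding P S) := by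
  refine T.hom_ext₃ (T.obj_mem _ _) (fun x y z => ?_)
  simp only [NatTrans.comp_app_apply, T.map_app_pure, T.assoc_app_pure, NatTrans.naturality_apply,
    T.pure_map_left, T.pure_map_right, NatTrans.id_app, id_apply, ← Functor.map_comp_apply,
    ← op_comp, T.braiding_app_pure, BraidedCategory.hexagon_forward, Category.assoc]

/-- The inverse of the associator, as a conjugate of the associator by symmetries. -/
def assocInv (P R S : Kᵒᵖ ⥤ Type u) : T.obj P (T.obj R S) ⟶ T.obj (T.obj P R) S :=
  T.braiding P (T.obj R S) ≫ T.map (T.braiding R S) (𝟙 P) ≫ T.assoc S R P ≫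
    T.map (𝟙 S) (T.braiding R P) ≫ T.braiding S (T.obj P R)

theorem assocInv_app_pure {a b c : K} (x : P.obj (op a)) (y : R.obj (op b)) (z : S.obj (op c)) :
    (T.assocInv P R S).app (op (a ⊗ (b ⊗ c))) (T.pure x (T.pure y z)) =
      (T.obj (T.obj P R) S).map (α_ a b c).inv.op (T.pure (T.pure x y) z) := by
  simp only [assocInv, NatTrans.comp_app_apply, T.map_app_pure, T.assoc_app_pure,
    NatTrans.naturality_apply, T.pure_map_left, T.pure_map_right, NatTrans.id_app, id_apply,
    ← Functor.map_comp_apply, ← op_comp, T.braiding_app_pure,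
    braiding_conj_associator]

theorem isIso_assoc (P R S : Kᵒᵖ ⥤ Type u) : IsIso (T.assoc P R S) := by
  refine ⟨T.assocInv P R S, T.hom_ext₃ (T.obj_mem _ _) (fun x y z => ?_),
    T.hom_ext₃_right (T.obj_mem _ _) (fun x y z => ?_)⟩
  all_goals
    simp only [NatTrans.comp_app_apply, T.assoc_app_pure, T.assocInv_app_pure,
      NatTrans.naturality_apply, ← Functor.map_comp_apply, ← op_comp, Iso.hom_inv_id,
      Iso.inv_hom_id, op_id, Functor.map_id_apply, NatTrans.id_app, id_apply]

/-- The inverse of the left unitor. -/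
def leftUnitorInv (P : Kᵒᵖ ⥤ Type u) : P ⟶ T.obj (yoneda.obj (𝟙_ K)) P where
  app a := ↾(fun y => (T.obj (yoneda.obj (𝟙_ K)) P).map (λ_ a.unop).inv.op
    (T.pure (P := yoneda.obj (𝟙_ K)) (𝟙 (𝟙_ K)) y))
  naturality a a' s := by
    ext y
    change (T.obj _ P).map (λ_ a'.unop).inv.op (T.pure _ (P.map s.unop.op y)) =
      (T.obj _ P).map s.unop.op ((T.obj _ P).map (λ_ a.unop).inv.op (T.pure _ y))
    simp only [T.pure_map_right, ← Functor.map_comp_apply, ← op_comp, leftUnitor_inv_naturality]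

theorem leftUnitorInv_app {a : K} (y : P.obj (op a)) :
    (T.leftUnitorInv P).app (op a) y =
      (T.obj (yoneda.obj (𝟙_ K)) P).map (λ_ a).inv.op
        (T.pure (P := yoneda.obj (𝟙_ K)) (𝟙 (𝟙_ K)) y) := rfl

theorem isIso_leftUnitor (hP : T.mem P) : IsIso (T.leftUnitor hP) := by
  refine ⟨T.leftUnitorInv P, T.hom_ext (T.obj_mem _ _) (fun {a b} i y => ?_), ?_⟩
  · have pure_eq : T.pure i y =
        (T.obj _ P).map (i ▷ b).op (T.pure (P := yoneda.obj (𝟙_ K)) (𝟙 (𝟙_ K)) y) := by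
      rw [← T.pure_map_left]
      simp
    rw [NatTrans.comp_app_apply, T.leftUnitor_app_pure, NatTrans.naturality_apply,
      T.leftUnitorInv_app, ← Functor.map_comp_apply, ← op_comp, pure_eq]
    simp
  · ext ⟨a⟩ y
    change (T.leftUnitor hP).app (op a) ((T.leftUnitorInv P).app (op a) y) = y
    rw [T.leftUnitorInv_app, NatTrans.naturality_apply, T.leftUnitor_app_pure,
      ← Functor.map_comp_apply, ← op_comp]
    simp

theorem isIso_rightUnitor (hP : T.mem P) : IsIso (T.rightUnitor hP) := by
  have := T.isIso_leftUnitor hP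
  have : IsIso (T.braiding P (yoneda.obj (𝟙_ K))) := ⟨_, T.symmetry _ _, T.symmetry _ _⟩
  rw [← T.braiding_leftUnitor hP]
  infer_instance

end SymmetricPresheafTensor

section DayConvolution

variable {K : Type u} [Category.{u} K] [MonoidalCategory K] {P P' R R' S Z : Kᵒᵖ ⥤ Type u}

/-- The pure tensor `x ⊗ y` in the Day convolution: the class of the generator with arrow `𝟙`. -/
def DayObj.pure {a b : K} (x : P.obj (op a)) (y : R.obj (op b)) :
    (day P R).obj (op (a ⊗ b)) := DayObj.mk (𝟙 (a ⊗ b)) x y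

theorem DayObj.mk_eq_map_pure {a b c : K} (f : c ⟶ a ⊗ b) (x : P.obj (op a))
    (y : R.obj (op b)) : DayObj.mk f x y = (day P R).map f.op (DayObj.pure x y) :=
  congrArg (DayObj.mk · x y) (Category.comp_id f).symm

theorem DayObj.map_pure {a a' b b' : K} (s : a ⟶ a') (t : b ⟶ b') (x : P.obj (op a'))
    (y : R.obj (op b')) :
    (day P R).map (s ⊗ₘ t).op (DayObj.pure x y) = DayObj.pure (P.map s.op x) (R.map t.op y) := by
  rw [← DayObj.mk_eq_map_pure, DayObj.pure, ← DayObj.glide, Category.id_comp]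

theorem day.hom_ext {f g : day P R ⟶ Z}
    (h : ∀ {a b : K} (x : P.obj (op a)) (y : R.obj (op b)),
      f.app (op (a ⊗ b)) (DayObj.pure x y) = g.app (op (a ⊗ b)) (DayObj.pure x y)) : f = g := by
  ext c q
  induction q using DayObj.ind with
  | h k x y =>
    rw [DayObj.mk_eq_map_pure]
    exact (NatTrans.naturality_apply f k.op _).trans
      ((congrArg (Z.map k.op) (h x y)).trans (NatTrans.naturality_apply g k.op _).symm)

theorem day.assoc_app_pure {a b c : K} (x : P.obj (op a)) (y : R.obj (op b)) (z : S.obj (op c)) :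
    (day.assoc P R S).app (op ((a ⊗ b) ⊗ c)) (DayObj.pure (DayObj.pure x y) z) =
      (day P (day R S)).map (α_ a b c).hom.op (DayObj.pure x (DayObj.pure y z)) := by
  rw [← DayObj.mk_eq_map_pure]
  refine congrArg (DayObj.mk (P := P) (R := day R S) · x (DayObj.mk (𝟙 (b ⊗ c)) y z)) ?_
  simp

theorem day.leftUnitor_app_pure {a b : K} (i : (yoneda.obj (𝟙_ K)).obj (op a))
    (y : P.obj (op b)) :
    (day.leftUnitor P).app (op (a ⊗ b)) (DayObj.pure i y) = P.map (i ▷ b ≫ (λ_ b).hom).op y :=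
  congrArg (fun k => P.map (Quiver.Hom.op k) y) (Category.id_comp _)

theorem day.rightUnitor_app_pure {a b : K} (x : P.obj (op a))
    (i : (yoneda.obj (𝟙_ K)).obj (op b)) :
    (day.rightUnitor P).app (op (a ⊗ b)) (DayObj.pure x i) = P.map (a ◁ i ≫ (ρ_ a).hom).op x :=
  congrArg (fun k => P.map (Quiver.Hom.op k) x) (Category.id_comp _)

theorem day.braiding_app_pure [BraidedCategory K] {a b : K} (x : P.obj (op a))
    (y : R.obj (op b)) :
    (day.braiding P R).app (op (a ⊗ b)) (DayObj.pure x y) =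
      (day R P).map (β_ a b).hom.op (DayObj.pure y x) :=
  (congrArg (DayObj.mk · y x) (Category.id_comp _)).trans (DayObj.mk_eq_map_pure _ y x)

variable (K) in
/-- The Day convolution of arbitrary presheaves. -/
def dayPresheafTensor [SymmetricCategory K] : SymmetricPresheafTensor K where
  mem := ⊤
  mem_shiftRight _ _ := trivial
  mem_shiftLeft _ _ := trivial
  obj := day
  obj_mem _ _ := trivial
  pure := DayObj.pure
  map_pure := DayObj.map_pure
  hom_ext _ _ _ h := day.hom_ext h
  map := day.map
  assoc := day.assoc
  leftUnitor _ := day.leftUnitor _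
  rightUnitor _ := day.rightUnitor _
  braiding := day.braiding
  map_app_pure _ _ _ _ _ _ := rfl
  assoc_app_pure := day.assoc_app_pure
  leftUnitor_app_pure _ := day.leftUnitor_app_pure
  rightUnitor_app_pure _ := day.rightUnitor_app_pure
  braiding_app_pure := day.braiding_app_pure

end DayConvolution

section Reflection

variable {Q : Type u} [Category.{u} Q] {P R S Z : Qᵒᵖ ⥤ Type u}

theorem prodPreserving_refl₀ (P : Qᵒᵖ ⥤ Type u) : prodPreserving Q (refl₀.obj P) :=
  (reflector.obj P).property

theorem refl₀_hom_ext (hZ : prodPreserving Q Z) {f g : refl₀.obj P ⟶ Z}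
    (h : reflUnit₀ P ≫ f = reflUnit₀ P ≫ g) : f = g := by
  have : (ObjectProperty.homMk f : reflector.obj P ⟶ ⟨Z, hZ⟩) = ObjectProperty.homMk g :=
    (reflectorAdj.homEquiv P ⟨Z, hZ⟩).injective (by
      rw [Adjunction.homEquiv_unit, Adjunction.homEquiv_unit]
      exact h)
  exact congrArg (prodPreserving Q).ι.map this

theorem refl₀_map_app_unit (m : P ⟶ R) {a : Qᵒᵖ} (x : P.obj a) :
    (refl₀.map m).app a ((reflUnit₀ P).app a x) = (reflUnit₀ R).app a (m.app a x) :=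
  (ConcreteCategory.congr_hom (NatTrans.congr_app (reflectorAdj.unit.naturality m) a) x).symm

theorem reflLift₀_app_unit (hZ : prodPreserving Q Z) (m : P ⟶ Z) {a : Qᵒᵖ} (x : P.obj a) :
    (reflLift₀ hZ m).app a ((reflUnit₀ P).app a x) = m.app a x :=
  ConcreteCategory.congr_hom (NatTrans.congr_app (reflLift₀_fac hZ m) a) x

theorem refl₀_map_unit_comp_reflLift₀ :
    refl₀.map (reflUnit₀ P) ≫ reflLift₀ (prodPreserving_refl₀ P) (𝟙 _) = 𝟙 _ := by
  refine refl₀_hom_ext (prodPreserving_refl₀ P) ?_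
  ext a x
  exact (congrArg ((reflLift₀ (prodPreserving_refl₀ P) (𝟙 _)).app a)
    (refl₀_map_app_unit (reflUnit₀ P) x)).trans (reflLift₀_app_unit _ (𝟙 _) _)

variable [MonoidalCategory Q]

theorem prodPreserving_shiftRight (b : Q)
    [PreservesColimitsOfShape (Discrete WalkingPair) (tensorRight b)]
    (hZ : prodPreserving Q Z) : prodPreserving Q ((tensorRight b).op ⋙ Z) := by
  have : PreservesLimitsOfShape (Discrete WalkingPair) Z := hZ
  have : PreservesColimitsOfShape (Discrete WalkingPair)ᵒᵖ (tensorRight b) :=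
    preservesColimitsOfShape_of_equiv (Discrete.opposite WalkingPair).symm _
  have : PreservesLimitsOfShape (Discrete WalkingPair) (tensorRight b).op :=
    preservesLimitsOfShape_op _ _
  exact inferInstanceAs
    (PreservesLimitsOfShape (Discrete WalkingPair) ((tensorRight b).op ⋙ Z))

theorem prodPreserving_shiftLeft [BraidedCategory Q] (a : Q)
    [PreservesColimitsOfShape (Discrete WalkingPair) (tensorRight a)]
    (hZ : prodPreserving Q Z) : prodPreserving Q ((tensorLeft a).op ⋙ Z) :=
  (prodPreserving Q).prop_of_iso
    (Functor.isoWhiskerRight (NatIso.op (BraidedCategory.tensorLeftIsoTensorRight a)) Z)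
    (prodPreserving_shiftRight a hZ)

variable [∀ X : Q, PreservesColimitsOfShape (Discrete WalkingPair) (tensorRight X)]

theorem dayExtend_app_pure (hZ : prodPreserving Q Z) (g : day P S ⟶ Z) {a b : Q}
    (x : P.obj (op a)) (y : S.obj (op b)) :
    (dayExtend hZ g).app (op (a ⊗ b)) (DayObj.pure ((reflUnit₀ P).app (op a) x) y) =
      g.app (op (a ⊗ b)) (DayObj.pure x y) :=
  ConcreteCategory.congr_hom (NatTrans.congr_app (dayExtend_fac hZ g) (op (a ⊗ b)))
    (DayObj.pure x y)

variable (Q) in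
/-- The reflection of the Day convolution into the product preserving presheaves. -/
noncomputable def reflPresheafTensor [SymmetricCategory Q] : SymmetricPresheafTensor Q where
  mem := prodPreserving Q
  mem_shiftRight b hZ := prodPreserving_shiftRight b hZ
  mem_shiftLeft a hZ := prodPreserving_shiftLeft a hZ
  obj P R := refl₀.obj (day P R)
  obj_mem _ _ := prodPreserving_refl₀ _
  pure {P R a b} x y := (reflUnit₀ (day P R)).app (op (a ⊗ b)) (DayObj.pure x y)
  map_pure s t x y := by rw [← NatTrans.naturality_apply, DayObj.map_pure]
  hom_ext hZ _ _ h := refl₀_hom_ext hZ (day.hom_ext h)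
  map m n := refl₀.map (day.map m n)
  assoc P R S := reflLift₀ (prodPreserving_refl₀ _) (dayExtend (prodPreserving_refl₀ _)
    ((day.assoc P R S ≫ day.map (𝟙 P) (reflUnit₀ (day R S))) ≫ reflUnit₀ _))
  leftUnitor {P} hP := refl₀.map (day.leftUnitor P) ≫ reflLift₀ hP (𝟙 P)
  rightUnitor {P} hP := refl₀.map (day.rightUnitor P) ≫ reflLift₀ hP (𝟙 P)
  braiding P R := refl₀.map (day.braiding P R)
  map_app_pure m n _ _ x y := refl₀_map_app_unit (day.map m n) (DayObj.pure x y)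
  assoc_app_pure x y z := by
    rw [reflLift₀_app_unit, dayExtend_app_pure, NatTrans.comp_app_apply, NatTrans.comp_app_apply,
      day.assoc_app_pure, NatTrans.naturality_apply, NatTrans.naturality_apply]
    rfl
  leftUnitor_app_pure hP _ _ i y := by
    rw [NatTrans.comp_app_apply, refl₀_map_app_unit, reflLift₀_app_unit, day.leftUnitor_app_pure]
    rfl
  rightUnitor_app_pure hP _ _ x i := by
    rw [NatTrans.comp_app_apply, refl₀_map_app_unit, reflLift₀_app_unit, day.rightUnitor_app_pure]
    rfl
  braiding_app_pure x y := by
    rw [refl₀_map_app_unit, day.braiding_app_pure, NatTrans.naturality_apply]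

end Reflection

namespace Interpretation

variable {Q : Type u} [Category.{u} Q] [MonoidalCategory Q] [SymmetricCategory Q]
  {𝓜 : Interpretation Q}

theorem Psh.nat₀_injective {F G : 𝓜.Psh} : Function.Injective (Psh.nat₀ (F := F) (G := G)) :=
  fun _ _ h => Nat₀.ext (funext fun X => funext fun x =>
    ConcreteCategory.congr_hom (NatTrans.congr_app h (op X.unop.ob)) x)

theorem Psh.nat₁_ext {F G : 𝓜.Psh} {α α' : Nat₁ F G} (h₀ : α.toNat₀ = α'.toNat₀)
    (h₁ : Psh.nat₁ α = Psh.nat₁ α') : α = α' :=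
  Nat₁.ext (funext fun X => Biset.hom_ext
    (fun x => congrFun (congrFun (congrArg Nat₀.app h₀) X) x)
    (fun x => ConcreteCategory.congr_hom (NatTrans.congr_app h₁ X) x))

theorem Psh.hom_ext {A : Biset.{u}} {F G : 𝓜.Psh} {φ ψ : A ⟶ (F ⟶[Biset.{u}] G)}
    (h₀ : ∀ a : A.zero, Psh.nat₀ (Biset.Hom.zero φ a) = Psh.nat₀ (Biset.Hom.zero ψ a))
    (h₁ : ∀ a : A.one, Psh.nat₁ (F := F) (G := G) (Biset.Hom.one φ a) =
      Psh.nat₁ (F := F) (G := G) (Biset.Hom.one ψ a)) : φ = ψ := by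
  have zero_eq : ∀ a, Biset.Hom.zero φ a = Biset.Hom.zero ψ a :=
    fun a => Psh.nat₀_injective (h₀ a)
  exact Biset.hom_ext zero_eq (fun a => Psh.nat₁_ext
    ((Biset.Hom.comm φ a).trans ((zero_eq _).trans (Biset.Hom.comm ψ a).symm)) (h₁ a))

/-- The natural transformation `F⁰ → G⁰` of a map `F → G` of `C̃`. -/
def level₀ {F G : 𝓜.Smooth} (f : EMap Biset.{u} F G) : F.obj.zero ⟶ G.obj.zero :=
  Psh.nat₀ (Biset.Hom.zero f PUnit.unit)

/-- The natural transformation `F¹ → G¹` of a map `F → G` of `C̃`. -/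
def level₁ {F G : 𝓜.Smooth} (f : EMap Biset.{u} F G) : F.obj.one ⟶ G.obj.one :=
  Psh.nat₁ (F := F.obj) (G := G.obj) (Biset.Hom.one f PUnit.unit)

theorem level_ext {F G : 𝓜.Smooth} {f g : EMap Biset.{u} F G} (h₀ : level₀ f = level₀ g)
    (h₁ : level₁ f = level₁ g) : f = g :=
  Psh.hom_ext (fun _ => h₀) (fun _ => h₁)

theorem level_comm {F G : 𝓜.Smooth} (f : EMap Biset.{u} F G) :
    level₁ f ≫ G.obj.str = F.obj.str ≫ Functor.whiskerLeft 𝓜.functor.op (level₀ f) := by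
  have toNat₀_one : Nat₁.toNat₀ (Biset.Hom.one f PUnit.unit) = Biset.Hom.zero f PUnit.unit :=
    Biset.Hom.comm f PUnit.unit
  rw [level₀, ← toNat₀_one]
  exact Psh.nat_comm (F := F.obj) (G := G.obj) (Biset.Hom.one f PUnit.unit)

theorem level₀_comp {F G H : 𝓜.Smooth} (f : EMap Biset.{u} F G) (g : EMap Biset.{u} G H) :
    level₀ (f.comp g) = level₀ f ≫ level₀ g := rfl

theorem level₁_comp {F G H : 𝓜.Smooth} (f : EMap Biset.{u} F G) (g : EMap Biset.{u} G H) :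
    level₁ (f.comp g) = level₁ f ≫ level₁ g := rfl

theorem level₀_id (F : 𝓜.Smooth) : level₀ (eId Biset.{u} F) = 𝟙 F.obj.zero := rfl

theorem level₁_id (F : 𝓜.Smooth) : level₁ (eId Biset.{u} F) = 𝟙 F.obj.one := rfl

section PrePost

variable {A : Biset.{u}} {F G H : 𝓜.Smooth}

theorem nat₀_post (φ : A ⟶ (F ⟶[Biset.{u}] G)) (g : EMap Biset.{u} G H) (p : A.zero) :
    Psh.nat₀ (F := F.obj) (G := H.obj) (Biset.Hom.zero (φ ≫ EMap.post F g) p) =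
      Psh.nat₀ (F := F.obj) (G := G.obj) (Biset.Hom.zero φ p) ≫ level₀ g := rfl

theorem nat₁_post (φ : A ⟶ (F ⟶[Biset.{u}] G)) (g : EMap Biset.{u} G H) (p : A.one) :
    Psh.nat₁ (F := F.obj) (G := H.obj) (Biset.Hom.one (φ ≫ EMap.post F g) p) =
      Psh.nat₁ (F := F.obj) (G := G.obj) (Biset.Hom.one φ p) ≫ level₁ g := rfl

theorem nat₀_pre (φ : A ⟶ (G ⟶[Biset.{u}] H)) (f : EMap Biset.{u} F G) (p : A.zero) :
    Psh.nat₀ (F := F.obj) (G := H.obj) (Biset.Hom.zero (φ ≫ EMap.pre f H) p) =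
      level₀ f ≫ Psh.nat₀ (F := G.obj) (G := H.obj) (Biset.Hom.zero φ p) := rfl

theorem nat₁_pre (φ : A ⟶ (G ⟶[Biset.{u}] H)) (f : EMap Biset.{u} F G) (p : A.one) :
    Psh.nat₁ (F := F.obj) (G := H.obj) (Biset.Hom.one (φ ≫ EMap.pre f H) p) =
      level₁ f ≫ Psh.nat₁ (F := G.obj) (G := H.obj) (Biset.Hom.one φ p) := rfl

end PrePost

theorem isInvertible_of_isIso_levels {F G : 𝓜.Smooth} (f : EMap Biset.{u} F G)
    (h₀ : IsIso (level₀ f)) (h₁ : IsIso (level₁ f)) : f.IsInvertible := by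
  have inv_comm : inv (level₁ f) ≫ F.obj.str =
      G.obj.str ≫ Functor.whiskerLeft 𝓜.functor.op (inv (level₀ f)) := by
    rw [IsIso.inv_comp_eq, ← Category.assoc, level_comm, Category.assoc,
      ← Functor.whiskerLeft_comp, IsIso.hom_inv_id]
    exact (Category.comp_id _).symm
  exact ⟨Biset.point (X := G.obj ⟶[Biset.{u}] F.obj)
      (Psh.ofNat₁ (F := G.obj) (G := F.obj) (inv (level₀ f)) (inv (level₁ f)) inv_comm),
    level_ext (IsIso.hom_inv_id (level₀ f)) (IsIso.hom_inv_id (level₁ f)),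
    level_ext (IsIso.inv_hom_id (level₀ f)) (IsIso.inv_hom_id (level₁ f))⟩

section Tensor

variable [∀ X : Q, PreservesColimitsOfShape (Discrete WalkingPair) (tensorRight X)]

theorem lamTensor_obj_zero (F G : 𝓜.Smooth) : (𝓜.lamTensor.obj F G).obj.zero =
    (reflPresheafTensor Q).obj F.obj.zero G.obj.zero := rfl

theorem lamTensor_obj_one (F G : 𝓜.Smooth) : (𝓜.lamTensor.obj F G).obj.one =
    (dayPresheafTensor 𝓜.Obj).obj F.obj.one G.obj.one := rfl

theorem level₀_tensorMap {F G H K : 𝓜.Smooth} (f : EMap Biset.{u} F G)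
    (g : EMap Biset.{u} H K) : level₀ (𝓜.lamTensor.tensorMap f g) =
      (reflPresheafTensor Q).map (level₀ f) (level₀ g) := rfl

theorem level₁_tensorMap {F G H K : 𝓜.Smooth} (f : EMap Biset.{u} F G)
    (g : EMap Biset.{u} H K) : level₁ (𝓜.lamTensor.tensorMap f g) =
      (dayPresheafTensor 𝓜.Obj).map (level₁ f) (level₁ g) := rfl

theorem level₀_assoc (F G H : 𝓜.Smooth) : level₀ (𝓜.lamTensor.assoc F G H) =
    (reflPresheafTensor Q).assoc F.obj.zero G.obj.zero H.obj.zero := rfl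

theorem level₁_assoc (F G H : 𝓜.Smooth) : level₁ (𝓜.lamTensor.assoc F G H) =
    (dayPresheafTensor 𝓜.Obj).assoc F.obj.one G.obj.one H.obj.one := by
  change ((dayPresheafTensor 𝓜.Obj).assoc F.obj.one G.obj.one H.obj.one ≫
    (dayPresheafTensor 𝓜.Obj).map (𝟙 _) (𝟙 _)) ≫ 𝟙 _ = _
  rw [SymmetricPresheafTensor.map_id, Category.comp_id, Category.comp_id]

theorem level₀_leftUnitor (F : 𝓜.Smooth) : level₀ (𝓜.lamTensor.leftUnitor F) =
    (reflPresheafTensor Q).leftUnitor F.prop := rfl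

theorem level₁_leftUnitor (F : 𝓜.Smooth) : level₁ (𝓜.lamTensor.leftUnitor F) =
    (dayPresheafTensor 𝓜.Obj).leftUnitor (P := F.obj.one) trivial := rfl

theorem level₀_rightUnitor (F : 𝓜.Smooth) : level₀ (𝓜.lamTensor.rightUnitor F) =
    (reflPresheafTensor Q).rightUnitor F.prop := rfl

theorem level₁_rightUnitor (F : 𝓜.Smooth) : level₁ (𝓜.lamTensor.rightUnitor F) =
    (dayPresheafTensor 𝓜.Obj).rightUnitor (P := F.obj.one) trivial := rfl

theorem level₀_braiding (F G : 𝓜.Smooth) : level₀ (𝓜.lamTensor.braiding F G) =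
    (reflPresheafTensor Q).braiding F.obj.zero G.obj.zero := rfl

theorem level₁_braiding (F G : 𝓜.Smooth) : level₁ (𝓜.lamTensor.braiding F G) =
    (dayPresheafTensor 𝓜.Obj).braiding F.obj.one G.obj.one := rfl

theorem lamTensor_assoc_natural (F₁ F₂ F₃ G₁ G₂ G₃ : 𝓜.Smooth) :
    (𝓜.lamTensor.hom F₁ F₂ G₁ G₂ ▷ (F₃ ⟶[Biset.{u}] G₃)) ≫ 𝓜.lamTensor.hom _ F₃ _ G₃ ≫
        EMap.post _ (𝓜.lamTensor.assoc G₁ G₂ G₃) =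
      (α_ _ _ _).hom ≫ ((F₁ ⟶[Biset.{u}] G₁) ◁ 𝓜.lamTensor.hom F₂ F₃ G₂ G₃) ≫
        𝓜.lamTensor.hom F₁ _ G₁ _ ≫ EMap.pre (𝓜.lamTensor.assoc F₁ F₂ F₃) _ := by
  simp only [← Category.assoc]
  refine Psh.hom_ext (fun p => ?_) (fun p => ?_)
  · refine (nat₀_post _ _ p).trans (Eq.trans ?_ (nat₀_pre _ _ p).symm)
    rw [level₀_assoc, level₀_assoc]
    exact (reflPresheafTensor Q).assoc_natural
      (Psh.nat₀ p.1.1) (Psh.nat₀ p.1.2) (Psh.nat₀ p.2)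
  · refine (nat₁_post _ _ p).trans (Eq.trans ?_ (nat₁_pre _ _ p).symm)
    rw [level₁_assoc, level₁_assoc]
    exact (dayPresheafTensor 𝓜.Obj).assoc_natural
      (Psh.nat₁ p.1.1) (Psh.nat₁ p.1.2) (Psh.nat₁ p.2)

theorem lamTensor_assoc_isInvertible (F G H : 𝓜.Smooth) :
    (𝓜.lamTensor.assoc F G H).IsInvertible :=
  isInvertible_of_isIso_levels _
    (by rw [level₀_assoc]; exact (reflPresheafTensor Q).isIso_assoc _ _ _)
    (by rw [level₁_assoc]; exact (dayPresheafTensor 𝓜.Obj).isIso_assoc _ _ _)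

theorem lamTensor_pentagon (F G H K : 𝓜.Smooth) :
    ((𝓜.lamTensor.tensorMap (𝓜.lamTensor.assoc F G H) (eId _ K)).comp
        (𝓜.lamTensor.assoc F (𝓜.lamTensor.obj G H) K)).comp
        (𝓜.lamTensor.tensorMap (eId _ F) (𝓜.lamTensor.assoc G H K)) =
      (𝓜.lamTensor.assoc (𝓜.lamTensor.obj F G) H K).comp
        (𝓜.lamTensor.assoc F G (𝓜.lamTensor.obj H K)) := by
  refine level_ext ?_ ?_
  · simp only [level₀_comp, level₀_tensorMap, level₀_assoc, level₀_id]
    dsimp only [lamTensor_obj_zero]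
    exact (reflPresheafTensor Q).pentagon F.obj.zero G.obj.zero H.obj.zero K.obj.zero
  · simp only [level₁_comp, level₁_tensorMap, level₁_assoc, level₁_id]
    dsimp only [lamTensor_obj_one]
    exact (dayPresheafTensor 𝓜.Obj).pentagon F.obj.one G.obj.one H.obj.one K.obj.one

theorem lamTensor_triangle (F G : 𝓜.Smooth) :
    (𝓜.lamTensor.assoc F 𝓜.lamTensor.unit G).comp
        (𝓜.lamTensor.tensorMap (eId _ F) (𝓜.lamTensor.leftUnitor G)) =
      𝓜.lamTensor.tensorMap (𝓜.lamTensor.rightUnitor F) (eId _ G) := by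
  refine level_ext ?_ ?_
  · simp only [level₀_comp, level₀_tensorMap, level₀_assoc, level₀_id, level₀_leftUnitor,
      level₀_rightUnitor]
    exact (reflPresheafTensor Q).triangle F.prop G.prop
  · simp only [level₁_comp, level₁_tensorMap, level₁_assoc, level₁_id, level₁_leftUnitor,
      level₁_rightUnitor]
    exact (dayPresheafTensor 𝓜.Obj).triangle trivial trivial

theorem lamTensor_hexagon (F G H : 𝓜.Smooth) :
    ((𝓜.lamTensor.assoc F G H).comp (𝓜.lamTensor.braiding F (𝓜.lamTensor.obj G H))).comp
        (𝓜.lamTensor.assoc G H F) =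
      ((𝓜.lamTensor.tensorMap (𝓜.lamTensor.braiding F G) (eId _ H)).comp
        (𝓜.lamTensor.assoc G F H)).comp
        (𝓜.lamTensor.tensorMap (eId _ G) (𝓜.lamTensor.braiding F H)) := by
  refine level_ext ?_ ?_
  · simp only [level₀_comp, level₀_tensorMap, level₀_assoc, level₀_id, level₀_braiding]
    dsimp only [lamTensor_obj_zero]
    exact (reflPresheafTensor Q).hexagon F.obj.zero G.obj.zero H.obj.zero
  · simp only [level₁_comp, level₁_tensorMap, level₁_assoc, level₁_id, level₁_braiding]
    dsimp only [lamTensor_obj_one]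
    exact (dayPresheafTensor 𝓜.Obj).hexagon F.obj.one G.obj.one H.obj.one

variable (𝓜) in
theorem lamTensor_isSymmetricMonoidal : 𝓜.lamTensor.IsSymmetricMonoidal where
  tensor_id _ _ :=
    level_ext ((reflPresheafTensor Q).map_id _ _) ((dayPresheafTensor 𝓜.Obj).map_id _ _)
  tensor_comp _ _ _ _ _ _ := Psh.hom_ext
    (fun p => (reflPresheafTensor Q).map_comp (Psh.nat₀ p.1.1) (Psh.nat₀ p.2.1)
      (Psh.nat₀ p.1.2) (Psh.nat₀ p.2.2))
    (fun p => (dayPresheafTensor 𝓜.Obj).map_comp (Psh.nat₁ p.1.1) (Psh.nat₁ p.2.1)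
      (Psh.nat₁ p.1.2) (Psh.nat₁ p.2.2))
  assoc_natural := lamTensor_assoc_natural
  leftUnitor_natural F G := Psh.hom_ext
    (fun p => (reflPresheafTensor Q).leftUnitor_natural F.prop G.prop (Psh.nat₀ p))
    (fun p => (dayPresheafTensor 𝓜.Obj).leftUnitor_natural trivial trivial (Psh.nat₁ p))
  rightUnitor_natural F G := Psh.hom_ext
    (fun p => (reflPresheafTensor Q).rightUnitor_natural F.prop G.prop (Psh.nat₀ p))
    (fun p => (dayPresheafTensor 𝓜.Obj).rightUnitor_natural trivial trivial (Psh.nat₁ p))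
  braiding_natural _ _ _ _ := Psh.hom_ext
    (fun p => (reflPresheafTensor Q).braiding_natural (Psh.nat₀ p.1) (Psh.nat₀ p.2))
    (fun p => (dayPresheafTensor 𝓜.Obj).braiding_natural (Psh.nat₁ p.1) (Psh.nat₁ p.2))
  assoc_invertible := lamTensor_assoc_isInvertible
  leftUnitor_invertible F := isInvertible_of_isIso_levels _
    ((reflPresheafTensor Q).isIso_leftUnitor F.prop)
    ((dayPresheafTensor 𝓜.Obj).isIso_leftUnitor trivial)
  rightUnitor_invertible F := isInvertible_of_isIso_levels _
    ((reflPresheafTensor Q).isIso_rightUnitor F.prop)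
    ((dayPresheafTensor 𝓜.Obj).isIso_rightUnitor trivial)
  symmetry _ _ :=
    level_ext ((reflPresheafTensor Q).symmetry _ _) ((dayPresheafTensor 𝓜.Obj).symmetry _ _)
  pentagon := lamTensor_pentagon
  triangle := lamTensor_triangle
  hexagon := lamTensor_hexagon

end Tensor

end Interpretation

theorem Biset.hom_ext_of_map_injective {X Y : Biset.{u}} (hY : Function.Injective Y.map)
    {f g : X ⟶ Y} (h : ∀ x, Biset.Hom.zero f x = Biset.Hom.zero g x) : f = g :=
  Biset.hom_ext h fun x =>
    hY ((Biset.Hom.comm f x).trans ((h _).trans (Biset.Hom.comm g x).symm))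

theorem Nat₁.toNat₀_injective {A : Type u} [EnrichedCategory Biset.{u} A]
    {F G : EnrichedFunctor Biset.{u} A Biset.{u}}
    (hG : ∀ X, Function.Injective (G.obj X).map) :
    Function.Injective (Nat₁.toNat₀ (F := F) (G := G)) :=
  fun _ _ h => Nat₁.ext (funext fun X => Biset.hom_ext_of_map_injective (hG X)
    (fun x => congrFun (congrFun (congrArg Nat₀.app h) X) x))

namespace Interpretation

variable {Q : Type u} [Category.{u} Q] [MonoidalCategory Q] [SymmetricCategory Q]
  {𝓜 : Interpretation Q}

theorem Ttilde_obj_map_injective (G : 𝓜.Smooth) (X : 𝓜.Objᵒᵖ) :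
    Function.Injective ((𝓜.Ttilde.obj G).obj.obj X).map :=
  Function.injective_id

theorem Ttilde_obj_zero (F : 𝓜.Smooth) : (𝓜.Ttilde.obj F).obj.zero = F.obj.zero := rfl

theorem Ttilde_hom_ext {A : Biset.{u}} {F G : 𝓜.Smooth}
    {φ ψ : A ⟶ (F ⟶[Biset.{u}] 𝓜.Ttilde.obj G)}
    (h : ∀ a : A.zero,
      Psh.nat₀ (F := F.obj) (G := (𝓜.Ttilde.obj G).obj) (Biset.Hom.zero φ a) =
        Psh.nat₀ (F := F.obj) (G := (𝓜.Ttilde.obj G).obj) (Biset.Hom.zero ψ a)) : φ = ψ :=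
  Biset.hom_ext_of_map_injective (Nat₁.toNat₀_injective (Ttilde_obj_map_injective G))
    (fun a => Psh.nat₀_injective (h a))

theorem Ttilde_level_ext {F G : 𝓜.Smooth} {f g : EMap Biset.{u} F (𝓜.Ttilde.obj G)}
    (h : level₀ f = level₀ g) : f = g :=
  Ttilde_hom_ext fun _ => h

theorem level₀_image {F G : 𝓜.Smooth} (f : EMap Biset.{u} F G) :
    level₀ (f.image 𝓜.Ttilde) = level₀ f := rfl

theorem level₀_etaTilde (F : 𝓜.Smooth) : level₀ (𝓜.etaTilde F) = 𝟙 F.obj.zero := rfl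

theorem level₀_muTilde (F : 𝓜.Smooth) : level₀ (𝓜.muTilde F) = 𝟙 F.obj.zero := rfl

variable (𝓜) in
theorem Ttilde_isVMonad : IsVMonad 𝓜.Ttilde 𝓜.etaTilde 𝓜.muTilde where
  unit_natural _ _ := Ttilde_hom_ext fun _ => rfl
  mul_natural _ _ := Ttilde_hom_ext fun _ => rfl
  assoc _ := Ttilde_level_ext rfl
  left_unit _ := Ttilde_level_ext rfl
  right_unit _ := Ttilde_level_ext rfl

section Strength

variable [∀ X : Q, PreservesColimitsOfShape (Discrete WalkingPair) (tensorRight X)]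

theorem level₀_tTilde (F G : 𝓜.Smooth) :
    level₀ (𝓜.tTilde F G) = 𝟙 ((reflPresheafTensor Q).obj F.obj.zero G.obj.zero) := by
  change ((reflPresheafTensor Q).map (𝟙 F.obj.zero) (𝟙 G.obj.zero) ≫ refl₀.map (𝟙 _)) ≫
    (refl₀.map (reflUnit₀ _) ≫ refl₀.map (𝟙 _)) ≫ reflLift₀ (prodPreserving_refl₀ _) (𝟙 _) = _
  rw [SymmetricPresheafTensor.map_id]
  simp only [CategoryTheory.Functor.map_id, Category.comp_id]
  exact (Category.id_comp _).trans refl₀_map_unit_comp_reflLift₀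

theorem level₀_costrength (F G : 𝓜.Smooth) :
    level₀ (costrength 𝓜.lamTensor 𝓜.Ttilde 𝓜.tTilde F G) =
      𝟙 ((reflPresheafTensor Q).obj F.obj.zero G.obj.zero) := by
  change ((reflPresheafTensor Q).braiding F.obj.zero G.obj.zero ≫ level₀ (𝓜.tTilde G F)) ≫
    (reflPresheafTensor Q).braiding G.obj.zero F.obj.zero = _
  rw [level₀_tTilde]
  dsimp only [Ttilde_obj_zero, lamTensor_obj_zero]
  rw [Category.comp_id, SymmetricPresheafTensor.symmetry]

theorem tTilde_natural (F₁ F₂ G₁ G₂ : 𝓜.Smooth) :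
    ((F₁ ⟶[Biset.{u}] G₁) ◁ 𝓜.Ttilde.map F₂ G₂) ≫
        𝓜.lamTensor.hom F₁ (𝓜.Ttilde.obj F₂) G₁ (𝓜.Ttilde.obj G₂) ≫
          EMap.post _ (𝓜.tTilde G₁ G₂) =
      𝓜.lamTensor.hom F₁ F₂ G₁ G₂ ≫ 𝓜.Ttilde.map _ _ ≫ EMap.pre (𝓜.tTilde F₁ F₂) _ := by
  simp only [← Category.assoc]
  refine Ttilde_hom_ext fun p =>
    (nat₀_post _ _ p).trans (Eq.trans ?_ (nat₀_pre _ _ p).symm)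
  rw [level₀_tTilde, level₀_tTilde]
  exact (Category.comp_id _).trans (Category.id_comp _).symm

theorem tTilde_unit (F G : 𝓜.Smooth) :
    (𝓜.lamTensor.tensorMap (eId Biset.{u} F) (𝓜.etaTilde G)).comp (𝓜.tTilde F G) =
      𝓜.etaTilde (𝓜.lamTensor.obj F G) := by
  refine Ttilde_level_ext ?_
  rw [level₀_comp, level₀_tensorMap, level₀_tTilde, level₀_id, level₀_etaTilde, level₀_etaTilde]
  dsimp only [lamTensor_obj_zero]
  exact (Category.comp_id _).trans ((reflPresheafTensor Q).map_id _ _)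

theorem tTilde_mul (F G : 𝓜.Smooth) :
    ((𝓜.tTilde F (𝓜.Ttilde.obj G)).comp ((𝓜.tTilde F G).image 𝓜.Ttilde)).comp
        (𝓜.muTilde (𝓜.lamTensor.obj F G)) =
      (𝓜.lamTensor.tensorMap (eId Biset.{u} F) (𝓜.muTilde G)).comp (𝓜.tTilde F G) := by
  refine Ttilde_level_ext ?_
  simp only [level₀_comp, level₀_tensorMap, level₀_tTilde, level₀_id, level₀_muTilde,
    level₀_image]
  dsimp only [lamTensor_obj_zero, Ttilde_obj_zero]
  rw [SymmetricPresheafTensor.map_id, Category.comp_id]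

theorem tTilde_assoc (F G H : 𝓜.Smooth) :
    (𝓜.tTilde (𝓜.lamTensor.obj F G) H).comp ((𝓜.lamTensor.assoc F G H).image 𝓜.Ttilde) =
      ((𝓜.lamTensor.assoc F G (𝓜.Ttilde.obj H)).comp
        (𝓜.lamTensor.tensorMap (eId Biset.{u} F) (𝓜.tTilde G H))).comp
          (𝓜.tTilde F (𝓜.lamTensor.obj G H)) := by
  refine Ttilde_level_ext ?_
  simp only [level₀_comp, level₀_tensorMap, level₀_tTilde, level₀_id, level₀_assoc,
    level₀_image]
  dsimp only [lamTensor_obj_zero, Ttilde_obj_zero]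
  rw [Category.id_comp, SymmetricPresheafTensor.map_id, Category.comp_id, Category.comp_id]

theorem tTilde_leftUnitor (F : 𝓜.Smooth) :
    (𝓜.tTilde 𝓜.lamTensor.unit F).comp ((𝓜.lamTensor.leftUnitor F).image 𝓜.Ttilde) =
      𝓜.lamTensor.leftUnitor (𝓜.Ttilde.obj F) := by
  refine Ttilde_level_ext ?_
  rw [level₀_comp, level₀_tTilde, level₀_image]
  exact Category.id_comp _

theorem tTilde_commutative (F G : 𝓜.Smooth) :
    ((costrength 𝓜.lamTensor 𝓜.Ttilde 𝓜.tTilde F (𝓜.Ttilde.obj G)).comp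
        ((𝓜.tTilde F G).image 𝓜.Ttilde)).comp (𝓜.muTilde (𝓜.lamTensor.obj F G)) =
      ((𝓜.tTilde (𝓜.Ttilde.obj F) G).comp
        ((costrength 𝓜.lamTensor 𝓜.Ttilde 𝓜.tTilde F G).image 𝓜.Ttilde)).comp
          (𝓜.muTilde (𝓜.lamTensor.obj F G)) := by
  refine Ttilde_level_ext ?_
  simp only [level₀_comp, level₀_image, level₀_tTilde, level₀_costrength]
  rfl

variable (𝓜) in
theorem Ttilde_isCommutativeStrongVMonad :
    IsCommutativeStrongVMonad 𝓜.lamTensor 𝓜.Ttilde 𝓜.etaTilde 𝓜.muTilde 𝓜.tTilde where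
  monad := 𝓜.Ttilde_isVMonad
  strength :=
    { natural := tTilde_natural
      unit := tTilde_unit
      mul := tTilde_mul
      assoc := tTilde_assoc
      leftUnitor := tTilde_leftUnitor }
  commutative := tTilde_commutative

end Strength

end Interpretation

theorem mainTheorem3 {Q : Type u} [Category.{u} Q] [MonoidalCategory Q] [SymmetricCategory Q]
    [∀ X : Q, PreservesColimitsOfShape (Discrete WalkingPair) (tensorRight X)]
    (𝓜 : Interpretation Q) :
    𝓜.lamTensor.IsSymmetricMonoidal ∧
      IsCommutativeStrongVMonad 𝓜.lamTensor 𝓜.Ttilde 𝓜.etaTilde 𝓜.muTilde 𝓜.tTilde :=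
  ⟨𝓜.lamTensor_isSymmetricMonoidal, 𝓜.Ttilde_isCommutativeStrongVMonad⟩
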